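/- \textbf{Setting.} Let $m,d,n\ge 1$ and $\widetilde n_1,\dots,\widetilde n_m\ge 1$ be integers, $b>0$, $\sigma_\epsilon>0$, and $\sigma_{\eta_j},\sigma_{\xi_j}\ge 0$. The target parameter is $\beta\sim\mathcal N(0,\tfrac bd I_d)$. For $j=1,\dots,m$ the $j$-th source task has parameter $\theta_j=H_j\beta+\eta_j$ with a fixed $H_j\in\mathbb R^{d\times d}$ and $\eta_j\sim\mathcal N(0,\tfrac{\sigma_{\eta_j}^2}{d}I_d)$, and data $v_j=Z_j\theta_j+\xi_j$, where $Z_j\in\mathbb R^{\widetilde n_j\times d}$ has i.i.d. rows distributed as $\mathcal N(0,I_d)$ and $\xi_j\in\mathbb R^{\widetilde n_j}$ has i.i.d. entries of mean $0$ and variance $\sigma_{\xi_j}^2$. The pretrained source model is $\widehat\theta_j=Z_j^+v_j$, with $Z_j^+$ the Moore--Penrose pseudoinverse. The target data are $y=X\beta+\epsilon$, where the $n$ rows of $X$ are i.i.d. with mean $0$ and covariance $I_d$, and $\epsilon$ has i.i.d. entries of mean $0$ and variance $\sigma_\epsilon^2$. A test pair $y^{\rm test}=x^{{\rm test},T}\beta+\epsilon^{\rm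 test}$ is drawn from the same target distribution, and $\beta$, all $\eta_j$, $Z_j$, $\xi_j$, $X$, $\epsilon$, $x^{\rm test}$, $\epsilon^{\rm test}$ are independent. For matrices $\widetilde H_j\in\mathbb R^{d\times d}$ such that $\sum_j\widetilde H_j^T\widetilde H_j$ has full rank, the transfer learning estimator with hyperparameter $\alpha>0$ is \[ \widehat\beta(\alpha)=\operatorname*{arg\,min}_{u\in\mathbb R^d}\ \|y-Xu\|_2^2+n\alpha\sum_{j=1}^m\|\widetilde H_ju-\widehat\theta_j\|_2^2 =\Big(X^TX+n\alpha\sum_{j}\widetilde H_j^T\widetilde H_j\Big)^{-1}\Big(X^Ty+n\alpha\sum_{j}\widetilde H_j^T\widehat\theta_j\Big), \] where the closed form is also used for $\alpha=0$ when $X^TX$ is invertible. Its expected test error, over all random quantities including $\beta$, is $\bar{\mathcal E}(\alpha)=\mathbb E\big(x^{{\rm test},T}\widehat\beta(\alpha)-y^{\rm test}\big)^2\in[0,\infty]$. Assume that the task relation is well specified and orthonormal: $\widetilde H_j=H_j$ and $H_j^TH_j=I_d$ for all $j$. Let $\rho_j=1$ if $\widetilde n_j\ge d$ and $\rho_j=\widetilde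 n_j/d$ if $\widetilde n_j<d$, let \[ C_j=\begin{cases}\frac{\sigma_{\eta_j}^2}{d}+\frac{\sigma_{\xi_j}^2}{\widetilde n_j-d-1}, & d\le\widetilde n_j-2,\\[2pt] \infty, & \widetilde n_j-1\le d\le\widetilde n_j+1,\\[2pt] \big(1-\frac{\widetilde n_j}{d}\big)\frac bd+\frac{\widetilde n_j}{d}\Big(\frac{\sigma_{\eta_j}^2}{d}+\frac{\sigma_{\xi_j}^2}{d-\widetilde n_j-1}\Big), & d\ge\widetilde n_j+2,\end{cases} \qquad A=\sum_{j=1}^mC_j+\frac{2b}{d}\sum_{l=1}^{m-1}\sum_{j=l+1}^m(1-\rho_j)(1-\rho_l), \] and assume $A\neq 0$, and $\sigma_{\xi_j}>0$ for every $j$ with $C_j=\infty$. Put \[ \alpha^{\rm opt}=\frac{m\sigma_\epsilon^2}{nA}\qquad(\text{so } \alpha^{\rm opt}=0 \text{ if some } C_j=\infty). \] \textbf{Theorem.} (a) If all $C_j$ are finite, then $\alpha^{\rm opt}>0$ is the unique minimizer of $\bar{\mathcal E}$ over $(0,\infty)$, and \[ \bar{\mathcal E}(\alpha^{\rm opt})=\sigma_\epsilon^2\Big(1+\mathbb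 E_X\operatorname{Tr}\big[(X^TX+mn\,\alpha^{\rm opt}I_d)^{-1}\big]\Big), \] where the expectation on the right is finite. (b) If some $C_j=\infty$, then $\alpha^{\rm opt}=0$ and $\bar{\mathcal E}(\alpha)=\infty$ for every $\alpha>0$. If moreover $X^TX$ is almost surely invertible, then the same formula $\bar{\mathcal E}(\alpha^{\rm opt})=\sigma_\epsilon^2\big(1+\mathbb E_X\operatorname{Tr}[(X^TX+mn\,\alpha^{\rm opt}I_d)^{-1}]\big)$ holds in $[0,\infty]$. -/

import Mathlib

open MeasureTheory ProbabilityTheory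
open scoped Matrix ENNReal

namespace TransferLearning

noncomputable section

/-! ### The Moore-Penrose pseudoinverse -/

/-- The Moore-Penrose pseudoinverse `Z⁺` of a real matrix: `(Zᵀ Z)⁺ Zᵀ`, where the pseudoinverse of
the symmetric matrix `Zᵀ Z` inverts its non-zero eigenvalues and keeps its zero eigenvalues
(`0⁻¹ = 0`). The four Penrose equations are proved below. -/
def pinv {p d : ℕ} (Z : Matrix (Fin p) (Fin d) ℝ) : Matrix (Fin d) (Fin p) ℝ :=
  let h := Matrix.isHermitian_conjTranspose_mul_self Z
  (h.eigenvectorUnitary : Matrix (Fin d) (Fin d) ℝ)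
    * Matrix.diagonal (fun i => (h.eigenvalues i)⁻¹)
    * (h.eigenvectorUnitary : Matrix (Fin d) (Fin d) ℝ)ᵀ * Zᵀ

theorem exists_pinv_eq {p d : ℕ} (Z : Matrix (Fin p) (Fin d) ℝ) :
    ∃ G : Matrix (Fin d) (Fin d) ℝ, pinv Z = G * Zᵀ ∧ Gᵀ = G ∧
      (Zᵀ * Z) * G * (Zᵀ * Z) = Zᵀ * Z ∧ G * (Zᵀ * Z) * G = G ∧ (Zᵀ * Z) * G = G * (Zᵀ * Z) := by
  set h := Matrix.isHermitian_conjTranspose_mul_self Z with hh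
  set U : Matrix (Fin d) (Fin d) ℝ := (h.eigenvectorUnitary : Matrix (Fin d) (Fin d) ℝ) with hU
  have hUU : Uᵀ * U = 1 := Unitary.coe_star_mul_self h.eigenvectorUnitary
  have hspec : Zᵀ * Z = U * Matrix.diagonal h.eigenvalues * Uᵀ := by
    have := h.spectral_theorem
    rw [Unitary.conjStarAlgAut_apply] at this
    exact this
  have key : ∀ e f : Fin d → ℝ, (U * Matrix.diagonal e * Uᵀ) * (U * Matrix.diagonal f * Uᵀ)
      = U * Matrix.diagonal (fun i => e i * f i) * Uᵀ := by
    intro e f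
    calc _ = U * Matrix.diagonal e * (Uᵀ * U) * Matrix.diagonal f * Uᵀ := by
          simp only [Matrix.mul_assoc]
      _ = _ := by
          rw [hUU, Matrix.mul_one, Matrix.mul_assoc U, Matrix.diagonal_mul_diagonal]
  refine ⟨U * Matrix.diagonal (fun i => (h.eigenvalues i)⁻¹) * Uᵀ, rfl, ?_, ?_, ?_, ?_⟩
  · simp [Matrix.transpose_mul, Matrix.mul_assoc]
  · rw [hspec, key, key]
    congr 3
    funext i
    by_cases hi : h.eigenvalues i = 0
    · rw [hi]; simp
    · field_simp
  · rw [hspec, key, key]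
    congr 3
    funext i
    by_cases hi : h.eigenvalues i = 0
    · rw [hi]; simp
    · field_simp
  · rw [hspec, key, key]
    congr 3
    funext i
    exact mul_comm _ _

theorem mul_pinv_mul {p d : ℕ} (Z : Matrix (Fin p) (Fin d) ℝ) : Z * pinv Z * Z = Z := by
  obtain ⟨G, hG, hGt, h1, -, -⟩ := exists_pinv_eq Z
  rw [hG]
  have hz : (Z * (G * Zᵀ) * Z - Z)ᵀ * (Z * (G * Zᵀ) * Z - Z) = 0 := by
    have e : (Z * (G * Zᵀ) * Z - Z)ᵀ * (Z * (G * Zᵀ) * Z - Z)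
        = ((Zᵀ * Z) * G * (Zᵀ * Z)) * G * (Zᵀ * Z) - (Zᵀ * Z) * G * (Zᵀ * Z)
          - ((Zᵀ * Z) * G * (Zᵀ * Z) - Zᵀ * Z) := by
      simp only [Matrix.transpose_sub, Matrix.transpose_mul, Matrix.transpose_transpose, hGt,
        Matrix.mul_sub, Matrix.sub_mul, Matrix.mul_assoc]
    rw [e, h1, h1]; simp
  rw [← Matrix.conjTranspose_eq_transpose_of_trivial, Matrix.conjTranspose_mul_self_eq_zero] at hz
  exact sub_eq_zero.mp hz

theorem pinv_mul_pinv {p d : ℕ} (Z : Matrix (Fin p) (Fin d) ℝ) : pinv Z * Z * pinv Z = pinv Z := by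
  obtain ⟨G, hG, -, -, h2, -⟩ := exists_pinv_eq Z
  calc pinv Z * Z * pinv Z = (G * (Zᵀ * Z) * G) * Zᵀ := by rw [hG]; simp only [Matrix.mul_assoc]
    _ = pinv Z := by rw [h2, hG]

theorem mul_pinv_symm {p d : ℕ} (Z : Matrix (Fin p) (Fin d) ℝ) : (Z * pinv Z)ᵀ = Z * pinv Z := by
  obtain ⟨G, hG, hGt, -, -, -⟩ := exists_pinv_eq Z
  simp [hG, Matrix.transpose_mul, hGt, Matrix.mul_assoc]

theorem pinv_mul_symm {p d : ℕ} (Z : Matrix (Fin p) (Fin d) ℝ) : (pinv Z * Z)ᵀ = pinv Z * Z := by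
  obtain ⟨G, hG, hGt, -, -, h3⟩ := exists_pinv_eq Z
  simp only [hG, Matrix.transpose_mul, Matrix.transpose_transpose, hGt]
  rw [← Matrix.mul_assoc, h3, Matrix.mul_assoc]

/-! ### The transfer learning estimator -/

/-- The squared Euclidean norm of a vector. -/
def sqNorm {p : ℕ} (v : Fin p → ℝ) : ℝ := v ⬝ᵥ v

/-- The transfer learning objective
`‖y - X b‖² + n α ∑ⱼ ‖H̃ⱼ b - θ̂ⱼ‖²`. -/
def objective {m d n : ℕ} (X : Matrix (Fin n) (Fin d) ℝ) (y : Fin n → ℝ)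
    (Ht : Fin m → Matrix (Fin d) (Fin d) ℝ) (θhat : Fin m → Fin d → ℝ) (α : ℝ)
    (v : Fin d → ℝ) : ℝ :=
  sqNorm (y - X *ᵥ v) + n * α * ∑ j, sqNorm (Ht j *ᵥ v - θhat j)

/-- The closed form
`(Xᵀ X + n α ∑ⱼ H̃ⱼᵀ H̃ⱼ)⁻¹ (Xᵀ y + n α ∑ⱼ H̃ⱼᵀ θ̂ⱼ)` of the transfer learning estimator; for `α > 0`
it is the unique minimizer of `objective`, see `objective_estimator_lt`. -/
def estimator {m d n : ℕ} (X : Matrix (Fin n) (Fin d) ℝ) (y : Fin n → ℝ)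
    (Ht : Fin m → Matrix (Fin d) (Fin d) ℝ) (θhat : Fin m → Fin d → ℝ) (α : ℝ) : Fin d → ℝ :=
  (Xᵀ * X + (n * α) • ∑ j, (Ht j)ᵀ * Ht j)⁻¹ *ᵥ
    (Xᵀ *ᵥ y + (n * α) • ∑ j, (Ht j)ᵀ *ᵥ θhat j)

theorem sqNorm_nonneg {p : ℕ} (v : Fin p → ℝ) : 0 ≤ sqNorm v := by
  unfold sqNorm dotProduct
  exact Finset.sum_nonneg fun i _ => mul_self_nonneg (v i)

theorem objective_estimator_lt {m d n : ℕ} (hn : 0 < n) (X : Matrix (Fin n) (Fin d) ℝ)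
    (y : Fin n → ℝ) (Ht : Fin m → Matrix (Fin d) (Fin d) ℝ) (θhat : Fin m → Fin d → ℝ) (α : ℝ)
    (hα : 0 < α) (hfull : IsUnit (∑ j, (Ht j)ᵀ * Ht j)) (v : Fin d → ℝ)
    (hv : v ≠ estimator X y Ht θhat α) :
    objective X y Ht θhat α (estimator X y Ht θhat α) < objective X y Ht θhat α v := by
  have hc : (0 : ℝ) < n * α := by positivity
  set c : ℝ := n * α with hcdef
  set K := Xᵀ * X + c • ∑ j, (Ht j)ᵀ * Ht j with hK
  have hquad : ∀ w : Fin d → ℝ,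
      w ⬝ᵥ (K *ᵥ w) = sqNorm (X *ᵥ w) + c * ∑ j, sqNorm (Ht j *ᵥ w) := by
    intro w
    simp only [hK, Matrix.add_mulVec, Matrix.smul_mulVec, Matrix.sum_mulVec, dotProduct_add,
      dotProduct_smul, dotProduct_sum, ← Matrix.mulVec_mulVec, sqNorm, smul_eq_mul]
    congr 1
    · rw [Matrix.dotProduct_mulVec, Matrix.vecMul_transpose]
    · congr 1
      refine Finset.sum_congr rfl fun j _ => ?_
      rw [Matrix.dotProduct_mulVec, Matrix.vecMul_transpose]
  have hpos : ∀ w : Fin d → ℝ, w ≠ 0 → 0 < sqNorm (X *ᵥ w) + c * ∑ j, sqNorm (Ht j *ᵥ w) := by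
    intro w hw
    have h0 := sqNorm_nonneg (X *ᵥ w)
    have h1 : 0 ≤ ∑ j, sqNorm (Ht j *ᵥ w) := Finset.sum_nonneg fun j _ => sqNorm_nonneg _
    rcases h1.lt_or_eq with h1 | h1
    · have := mul_pos hc h1
      linarith
    · exfalso
      have hz : ∀ j, Ht j *ᵥ w = 0 := by
        intro j
        have := (Finset.sum_eq_zero_iff_of_nonneg (fun j _ => sqNorm_nonneg (Ht j *ᵥ w))).1 h1.symm
          j (Finset.mem_univ j)
        exact dotProduct_self_eq_zero.1 this
      apply hw
      have hs : (∑ j, (Ht j)ᵀ * Ht j) *ᵥ w = 0 := by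
        simp [Matrix.sum_mulVec, ← Matrix.mulVec_mulVec, hz]
      have hinj := Matrix.mulVec_injective_of_isUnit hfull
      exact hinj (by simpa using hs)
  have hKu : IsUnit K := by
    rw [← Matrix.mulVec_injective_iff_isUnit]
    intro u w huw
    by_contra hne
    have h := hpos (u - w) (sub_ne_zero.2 hne)
    rw [← hquad, Matrix.mulVec_sub, show K *ᵥ u = K *ᵥ w from huw] at h
    simp at h
  set e := estimator X y Ht θhat α with he
  have hKe : K *ᵥ e = Xᵀ *ᵥ y + c • ∑ j, (Ht j)ᵀ *ᵥ θhat j := by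
    rw [he, estimator, Matrix.mulVec_mulVec, ← hcdef, ← hK,
      Matrix.mul_nonsing_inv _ ((Matrix.isUnit_iff_isUnit_det _).1 hKu), Matrix.one_mulVec]
  set w := v - e with hw
  have hwne : w ≠ 0 := sub_ne_zero.2 hv
  have hvw : v = e + w := by simp [hw]
  have hcross : -((X *ᵥ w) ⬝ᵥ (y - X *ᵥ e))
      + c * ∑ j, (Ht j *ᵥ w) ⬝ᵥ (Ht j *ᵥ e - θhat j) = 0 := by
    have h : w ⬝ᵥ (K *ᵥ e) - w ⬝ᵥ (Xᵀ *ᵥ y + c • ∑ j, (Ht j)ᵀ *ᵥ θhat j) = 0 := by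
      rw [hKe, sub_self]
    have t : ∀ {p : ℕ} (A : Matrix (Fin p) (Fin d) ℝ) (u : Fin p → ℝ),
        w ⬝ᵥ (Aᵀ *ᵥ u) = (A *ᵥ w) ⬝ᵥ u := by
      intro p A u
      rw [Matrix.dotProduct_mulVec, Matrix.vecMul_transpose]
    simp only [hK, Matrix.add_mulVec, Matrix.smul_mulVec, Matrix.sum_mulVec, dotProduct_add,
      dotProduct_smul, dotProduct_sum, ← Matrix.mulVec_mulVec, smul_eq_mul, t] at h
    simp only [dotProduct_sub, Finset.sum_sub_distrib]
    linarith
  have hexp : objective X y Ht θhat α v = objective X y Ht θhat α e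
      + 2 * (-((X *ᵥ w) ⬝ᵥ (y - X *ᵥ e)) + c * ∑ j, (Ht j *ᵥ w) ⬝ᵥ (Ht j *ᵥ e - θhat j))
      + (sqNorm (X *ᵥ w) + c * ∑ j, sqNorm (Ht j *ᵥ w)) := by
    have a1 : sqNorm (y - X *ᵥ v) = sqNorm (y - X *ᵥ e) - 2 * ((X *ᵥ w) ⬝ᵥ (y - X *ᵥ e))
        + sqNorm (X *ᵥ w) := by
      have : y - X *ᵥ v = (y - X *ᵥ e) - X *ᵥ w := by rw [hvw, Matrix.mulVec_add]; abel
      rw [this]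
      simp only [sqNorm, sub_dotProduct _ (X *ᵥ w), dotProduct_sub _ _ (X *ᵥ w)]
      rw [dotProduct_comm (y - X *ᵥ e) (X *ᵥ w)]
      ring
    have a2 : ∀ j, sqNorm (Ht j *ᵥ v - θhat j) = sqNorm (Ht j *ᵥ e - θhat j)
        + 2 * ((Ht j *ᵥ w) ⬝ᵥ (Ht j *ᵥ e - θhat j)) + sqNorm (Ht j *ᵥ w) := by
      intro j
      have : Ht j *ᵥ v - θhat j = (Ht j *ᵥ e - θhat j) + Ht j *ᵥ w := by
        rw [hvw, Matrix.mulVec_add]; abel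
      rw [this]
      simp only [sqNorm, add_dotProduct _ (Ht j *ᵥ w), dotProduct_add _ _ (Ht j *ᵥ w)]
      rw [dotProduct_comm (Ht j *ᵥ e - θhat j) (Ht j *ᵥ w)]
      ring
    simp only [objective, a1, a2, Finset.sum_add_distrib, ← Finset.mul_sum, ← hcdef]
    ring
  rw [hexp, hcross]
  have := hpos w hwne
  linarith

/-! ### One realization of all the random quantities -/

/-- A realization of all the random quantities: the target parameter, the task noises, the data and
noises of the `m` source tasks (source `j` has `nt j` examples, the rows of `Z j`), the data and
noise of the target task (`n` examples, the rows of `X`), and the test input and test noise. -/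
structure Sample (m d n : ℕ) (nt : Fin m → ℕ) where
  /-- target parameter -/
  β : Fin d → ℝ
  /-- task-relation noises -/
  η : Fin m → Fin d → ℝ
  /-- source inputs -/
  Z : (j : Fin m) → Matrix (Fin (nt j)) (Fin d) ℝ
  /-- source noises -/
  ξ : (j : Fin m) → Fin (nt j) → ℝ
  /-- target inputs -/
  X : Matrix (Fin n) (Fin d) ℝ
  /-- target noise -/
  ε : Fin n → ℝ
  /-- test input -/
  xtest : Fin d → ℝ
  /-- test noise -/
  εtest : ℝ

namespace Sample

variable {m d n : ℕ} {nt : Fin m → ℕ}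

/-- Source parameter `θⱼ = Hⱼ β + ηⱼ`. -/
def θ (s : Sample m d n nt) (H : Fin m → Matrix (Fin d) (Fin d) ℝ) (j : Fin m) : Fin d → ℝ :=
  H j *ᵥ s.β + s.η j

/-- Source outputs `vⱼ = Zⱼ θⱼ + ξⱼ`. -/
def v (s : Sample m d n nt) (H : Fin m → Matrix (Fin d) (Fin d) ℝ) (j : Fin m) :
    Fin (nt j) → ℝ :=
  s.Z j *ᵥ s.θ H j + s.ξ j

/-- Pretrained source model `θ̂ⱼ = Zⱼ⁺ vⱼ`. -/
def θhat (s : Sample m d n nt) (H : Fin m → Matrix (Fin d) (Fin d) ℝ) (j : Fin m) : Fin d → ℝ :=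
  pinv (s.Z j) *ᵥ s.v H j

/-- Target outputs `y = X β + ε`. -/
def y (s : Sample m d n nt) : Fin n → ℝ := s.X *ᵥ s.β + s.ε

/-- Test output. -/
def ytest (s : Sample m d n nt) : ℝ := s.xtest ⬝ᵥ s.β + s.εtest

/-- The learned target parameter with hyperparameter `α`: the data are generated with the true
task relations `H`, the learner uses `Ht`. -/
def βhat (s : Sample m d n nt) (H Ht : Fin m → Matrix (Fin d) (Fin d) ℝ) (α : ℝ) : Fin d → ℝ :=
  estimator s.X s.y Ht (s.θhat H) α

/-- A realization as a tuple. -/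
def toTuple (s : Sample m d n nt) :
    (Fin d → ℝ) × (Fin m → Fin d → ℝ) × ((j : Fin m) → Fin (nt j) → Fin d → ℝ) ×
      ((j : Fin m) → Fin (nt j) → ℝ) × (Fin n → Fin d → ℝ) × (Fin n → ℝ) × (Fin d → ℝ) × ℝ :=
  (s.β, s.η, s.Z, s.ξ, s.X, s.ε, s.xtest, s.εtest)

end Sample

/-! ### Distributions -/

/-- The isotropic Gaussian distribution `N(0, t I_d)`, for `t ≥ 0`. -/
def isoGaussian (d : ℕ) (t : ℝ) : Measure (Fin d → ℝ) :=
  Measure.pi fun _ => gaussianReal 0 t.toNNReal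

/-- `ν` is a probability distribution on `ℝ` with mean zero and variance `t`. -/
structure IsNoise (ν : Measure ℝ) (t : ℝ) : Prop where
  prob : IsProbabilityMeasure ν
  memLp : MemLp (fun u : ℝ => u) 2 ν
  mean : ∫ u, u ∂ν = 0
  var : ∫ u, u ^ 2 ∂ν = t

/-- `ν` is a probability distribution on `ℝ^d` with mean zero and covariance matrix `I_d`. -/
structure IsIsotropic {d : ℕ} (ν : Measure (Fin d → ℝ)) : Prop where
  prob : IsProbabilityMeasure ν
  memLp : ∀ k, MemLp (fun u : Fin d → ℝ => u k) 2 ν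
  mean : ∀ k, ∫ u, u k ∂ν = 0
  cov : ∀ k l, ∫ u, u k * u l ∂ν = (1 : Matrix (Fin d) (Fin d) ℝ) k l

/-- The joint distribution of all the random quantities. They are independent (hence the product
measure) with `β ∼ N(0, (b/d) I_d)`, `ηⱼ ∼ N(0, (σηⱼ²/d) I_d)`, the rows of `Zⱼ` i.i.d. `N(0, I_d)`,
the entries of `ξⱼ` i.i.d. `νξ j`, the rows of `X` and the test input i.i.d. `νx`, and the entries of
`ε` and the test noise i.i.d. `νε`. -/
def jointLaw (m d n : ℕ) (nt : Fin m → ℕ) (b : ℝ) (ση : Fin m → ℝ)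
    (νξ : Fin m → Measure ℝ) (νx : Measure (Fin d → ℝ)) (νε : Measure ℝ) :
    Measure ((Fin d → ℝ) × (Fin m → Fin d → ℝ) × ((j : Fin m) → Fin (nt j) → Fin d → ℝ) ×
      ((j : Fin m) → Fin (nt j) → ℝ) × (Fin n → Fin d → ℝ) × (Fin n → ℝ) × (Fin d → ℝ) × ℝ) :=
  (isoGaussian d (b / d)).prod <|
  (Measure.pi fun j => isoGaussian d (ση j ^ 2 / d)).prod <|
  (Measure.pi fun j => Measure.pi fun _ : Fin (nt j) => isoGaussian d 1).prod <|
  (Measure.pi fun j => Measure.pi fun _ : Fin (nt j) => νξ j).prod <|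
  (Measure.pi fun _ : Fin n => νx).prod <|
  (Measure.pi fun _ : Fin n => νε).prod <|
  νx.prod νε

/-- The expected test error `E (xtestᵀ β̂ - ytest)²`, over all random quantities including `β`;
it is an extended non-negative real, because it can be infinite. -/
def testError {Ω : Type*} [MeasurableSpace Ω] (P : Measure Ω) {m d n : ℕ} {nt : Fin m → ℕ}
    (S : Ω → Sample m d n nt) (H Ht : Fin m → Matrix (Fin d) (Fin d) ℝ) (α : ℝ) : ℝ≥0∞ :=
  ∫⁻ ω, ENNReal.ofReal (((S ω).xtest ⬝ᵥ (S ω).βhat H Ht α - (S ω).ytest) ^ 2) ∂P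

/-! ### The constants -/

/-- The overparameterization bias factor `ρ` of a source task with `p` examples. -/
def biasFactor (d p : ℕ) : ℝ := if d ≤ p then 1 else (p : ℝ) / d

/-- The constant `Cⱼ` of a source task with `p` examples and variances `ση²`, `σξ²`. -/
def sourceConst (d p : ℕ) (b ση σξ : ℝ) : ℝ≥0∞ :=
  if d + 2 ≤ p then
    ENNReal.ofReal (ση ^ 2 / d + σξ ^ 2 / ((p : ℝ) - d - 1))
  else if p + 2 ≤ d then
    ENNReal.ofReal ((1 - (p : ℝ) / d) * (b / d)
      + (p : ℝ) / d * (ση ^ 2 / d + σξ ^ 2 / ((d : ℝ) - p - 1)))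
  else ⊤

/-- `∑ⱼ Cⱼ + (2 b / d) ∑_{l < j} (1 - ρⱼ) (1 - ρₗ)`. -/
def totalConst {m : ℕ} (d : ℕ) (nt : Fin m → ℕ) (b : ℝ) (ση σξ : Fin m → ℝ) : ℝ≥0∞ :=
  ∑ j, sourceConst d (nt j) b (ση j) (σξ j)
    + ENNReal.ofReal (2 * b / d *
        ∑ l, ∑ j ∈ Finset.Ioi l, (1 - biasFactor d (nt j)) * (1 - biasFactor d (nt l)))

/-- The optimal hyperparameter
`m σε² / (n (∑ⱼ Cⱼ + (2 b / d) ∑_{l < j} (1 - ρⱼ) (1 - ρₗ)))`, which is `0` if some `Cⱼ` is `∞`. -/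
def alphaOpt {m : ℕ} (d n : ℕ) (nt : Fin m → ℕ) (b σε : ℝ) (ση σξ : Fin m → ℝ) : ℝ :=
  (m * ENNReal.ofReal (σε ^ 2) / (n * totalConst d nt b ση σξ)).toReal

end

end TransferLearning

/-!
# Optimal regularization for transfer learning with orthonormal task relations

Write `K = Xᵀ X + m n α I`. Since `Hⱼᵀ Hⱼ = I`, the estimation error is a linear form in the
independent centered variables `β, ηⱼ, ξⱼ, ε` once the designs `X` and `Zⱼ` are fixed
(`βhat_eq`):
`β̂ - β = K⁻¹ Xᵀ ε + n α K⁻¹ ∑ⱼ (Hⱼᵀ (Pⱼ - I) Hⱼ β + Hⱼᵀ Pⱼ ηⱼ + Hⱼᵀ Zⱼ⁺ ξⱼ)`, `Pⱼ = Zⱼ⁺ Zⱼ`.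
The test input is isotropic, so the conditional test error is `σε²` plus a sum of variances times
squared Frobenius norms of these coefficients (`lintegral_sq_linear_error`,
`testError_eq_lintegral_condError`).

Next the source designs are averaged out. The law of `Zⱼ` is invariant under right multiplication by
orthogonal matrices, hence `E Pⱼ` and `E Zⱼ⁺ Zⱼ⁺ᵀ` are multiples of the identity
(`hasMean_of_orthogonal_equivariant`), determined by their traces. The trace of `Pⱼ` is the rank of
`Zⱼ`, almost surely `min ñⱼ d`. The trace of `Zⱼ⁺ Zⱼ⁺ᵀ` is that of an inverse Wishart matrix, whose
diagonal entries are inverse squared distances from a Gaussian vector to an independent subspace,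
that is, inverse chi-square variables (`lintegral_trace_inv_gram`). This is where the constants `Cⱼ`
come from, and why the error is infinite at an interpolation threshold
(`lintegral_condError_eq_top`). Away from the thresholds the sum over `j` has second moment `A I`
with `A` the denominator constant, and the error given `X` is
`φ(α) = σε² + σε² ‖K⁻¹ Xᵀ‖² + (n α)² A ‖K⁻¹‖²` (`lintegral_condError`, `totalConst_eq_ofReal`).

It remains to minimize over `α`. The identity `‖K⁻¹ Xᵀ‖² + m n α ‖K⁻¹‖² = tr K⁻¹` shows that
`φ = σε² (1 + tr K⁻¹)` when `n α A = m σε²`; call this parameter `γ`. The resolvent identity gives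
`φ(α) - φ(γ) = A n² (α - γ)² tr (X K(α)⁻¹ K(γ)⁻¹ K(α)⁻¹ Xᵀ)` (`designError_sub`), which is
non-negative and positive unless `X = 0`. So one and the same `γ` is optimal for every design, and
it is the unique minimizer on average because an isotropic design is not almost surely zero.
-/

namespace TransferLearning

noncomputable section

/-! ### Standard Gaussian vectors and matrices -/

instance isProbabilityMeasure_isoGaussian (d : ℕ) (t : ℝ) :
    IsProbabilityMeasure (isoGaussian d t) := by
  unfold isoGaussian; infer_instance

/-- The law of a `p × d` matrix with i.i.d. standard Gaussian entries, given by its rows. -/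
def gaussianMatrix (p d : ℕ) : Measure (Fin p → Fin d → ℝ) :=
  Measure.pi fun _ => isoGaussian d 1

instance isProbabilityMeasure_gaussianMatrix (p d : ℕ) :
    IsProbabilityMeasure (gaussianMatrix p d) := by
  unfold gaussianMatrix; infer_instance

/-- The coordinates of a standard Gaussian vector along an orthonormal family form a standard
Gaussian vector. -/
theorem measurePreserving_inner_orthonormal {N r : ℕ} (v : Fin r → EuclideanSpace ℝ (Fin N))
    (hv : Orthonormal ℝ v) :
    MeasurePreserving (fun (z : Fin N → ℝ) (i : Fin r) => v i ⬝ᵥ z)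
      (isoGaussian N 1) (isoGaussian r 1) := by
  have hmeas : Measurable (fun (z : Fin N → ℝ) (i : Fin r) => v i ⬝ᵥ z) := by
    unfold dotProduct; fun_prop
  refine ⟨hmeas, ?_⟩
  have hinj : Function.Injective
      (Measure.map (MeasurableEquiv.toLp 2 (Fin r → ℝ))) :=
    (MeasurableEquiv.toLp 2 (Fin r → ℝ)).map_measurableEquiv_injective
  apply hinj
  rw [Measure.map_map (MeasurableEquiv.measurable _) hmeas]
  have h1 : Measure.map (MeasurableEquiv.toLp 2 (Fin r → ℝ)) (isoGaussian r 1)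
      = stdGaussian (EuclideanSpace ℝ (Fin r)) := by
    rw [← map_pi_eq_stdGaussian, isoGaussian, Real.toNNReal_one]; rfl
  rw [h1]
  have : IsProbabilityMeasure (Measure.map ((MeasurableEquiv.toLp 2 (Fin r → ℝ)) ∘
      fun (z : Fin N → ℝ) (i : Fin r) => v i ⬝ᵥ z) (isoGaussian N 1)) :=
    Measure.isProbabilityMeasure_map
      ((MeasurableEquiv.measurable _).comp hmeas).aemeasurable
  apply Measure.ext_of_charFun
  ext t
  rw [charFun_stdGaussian, charFun_apply, integral_map]
  · have h2 := charFun_stdGaussian (∑ i, t i • v i)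
    rw [← map_pi_eq_stdGaussian, charFun_apply, integral_map] at h2
    · have hn : ‖∑ i, t i • v i‖ ^ 2 = ‖t‖ ^ 2 := by
        rw [← real_inner_self_eq_norm_sq, hv.inner_sum, EuclideanSpace.real_norm_sq_eq]
        simp [sq]
      have hn' : (‖∑ i, t i • v i‖ : ℂ) ^ 2 = (‖t‖ : ℂ) ^ 2 := by exact_mod_cast hn
      rw [hn'] at h2
      rw [← h2, isoGaussian, Real.toNNReal_one]
      congr 1
      ext z
      congr 2
      norm_cast
      simp only [Function.comp_apply, inner_sum, inner_smul_right, PiLp.inner_apply,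
        MeasurableEquiv.coe_toLp, dotProduct, RCLike.inner_apply, conj_trivial]
    · exact (MeasurableEquiv.measurable (MeasurableEquiv.toLp 2 (Fin N → ℝ))).aemeasurable
    · exact Measurable.aestronglyMeasurable (by fun_prop)
  · exact ((MeasurableEquiv.measurable _).comp hmeas).aemeasurable
  · exact Measurable.aestronglyMeasurable (by fun_prop)

theorem measurePreserving_transpose_gaussianMatrix (p d : ℕ) :
    MeasurePreserving (fun (Z : Fin p → Fin d → ℝ) k i => Z i k)
      (gaussianMatrix p d) (gaussianMatrix d p) := by
  have key : ∀ p d : ℕ, MeasurePreserving (MeasurableEquiv.curry (Fin p) (Fin d) ℝ).symm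
      (gaussianMatrix p d) (Measure.pi fun _ : Fin p × Fin d => gaussianReal 0 (1 : ℝ).toNNReal) := by
    intro p d
    refine ⟨MeasurableEquiv.measurable _, (Measure.pi_eq fun s hs => ?_).symm⟩
    rw [MeasurableEquiv.map_apply, gaussianMatrix]
    have : (MeasurableEquiv.curry (Fin p) (Fin d) ℝ).symm ⁻¹' Set.univ.pi s
        = Set.univ.pi fun i => Set.univ.pi fun j => s (i, j) := by
      ext f
      simp [Set.mem_pi, Prod.forall]
    rw [this, Measure.pi_pi]
    simp only [isoGaussian, Measure.pi_pi]
    rw [Fintype.prod_prod_type]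
  have h2 := measurePreserving_piCongrLeft
    (fun _ : Fin d × Fin p => gaussianReal 0 (1 : ℝ).toNNReal) (Equiv.prodComm (Fin p) (Fin d))
  exact ((key d p).symm _).comp (h2.comp (key p d))

/-- A standard Gaussian vector avoids a given proper subspace: its coordinate along a unit normal
vector of the subspace is a standard Gaussian variable. -/
theorem ae_notMem_submodule_isoGaussian {N : ℕ} (V : Submodule ℝ (Fin N → ℝ)) (hV : V ≠ ⊤) :
    ∀ᵐ x ∂isoGaussian N 1, x ∉ V := by
  set V' : Submodule ℝ (EuclideanSpace ℝ (Fin N)) :=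
    V.comap (WithLp.linearEquiv 2 ℝ (Fin N → ℝ)).toLinearMap with hV'
  have hne : V'ᗮ ≠ ⊥ := by
    rw [Ne, Submodule.orthogonal_eq_bot_iff]
    intro h
    apply hV
    rw [Submodule.eq_top_iff'] at h ⊢
    intro x
    exact h (WithLp.toLp 2 x)
  obtain ⟨a, haV, ha0⟩ := Submodule.exists_mem_ne_zero_of_ne_bot hne
  set u : Fin 1 → EuclideanSpace ℝ (Fin N) := fun _ => (‖a‖⁻¹ : ℝ) • a with hu
  have hon : Orthonormal ℝ u := by
    refine ⟨fun _ => ?_, fun i j hij => absurd (Subsingleton.elim i j) hij⟩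
    rw [hu, norm_smul, norm_inv, norm_norm, inv_mul_cancel₀ (norm_ne_zero_iff.2 ha0)]
  have hmp := measurePreserving_inner_orthonormal u hon
  have h0 : ∀ᵐ y ∂isoGaussian 1 1, y 0 ≠ 0 := by
    have hg : ∀ᵐ x ∂gaussianReal 0 (1 : ℝ).toNNReal, x ≠ 0 := by
      have : NullSingletonClass (gaussianReal 0 (1 : ℝ).toNNReal) :=
        nullSingletonClass_gaussianReal (by simp)
      exact Measure.ae_ne _ 0
    exact (Measure.quasiMeasurePreserving_eval (fun _ : Fin 1 =>
      gaussianReal 0 (1 : ℝ).toNNReal) 0).ae hg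
  filter_upwards [hmp.quasiMeasurePreserving.ae h0] with x hx hxV
  apply hx
  have hin : inner ℝ (WithLp.toLp 2 x) a = (0 : ℝ) :=
    (Submodule.mem_orthogonal _ _).1 haV _ hxV
  have : (u 0).ofLp ⬝ᵥ x = ‖a‖⁻¹ * inner ℝ (WithLp.toLp 2 x) a := by
    simp [hu, dotProduct, PiLp.inner_apply, Finset.mul_sum, mul_assoc]
  rw [this, hin, mul_zero]

/-- The rows of a Gaussian matrix with no more rows than columns are almost surely linearly
independent: given the other rows, a row avoids their span. -/
theorem linearIndependent_gaussianMatrix {q N : ℕ} (hq : q ≤ N) :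
    ∀ᵐ W ∂gaussianMatrix q N, LinearIndependent ℝ W := by
  induction q with
  | zero => exact Filter.Eventually.of_forall fun W => linearIndependent_empty_type
  | succ q ih =>
    have hmp := measurePreserving_piFinSuccAbove
      (fun _ : Fin (q + 1) => isoGaussian N 1) 0
    have hms : MeasurableSet {x : (Fin N → ℝ) × (Fin q → Fin N → ℝ) |
        LinearIndependent ℝ (Fin.cons x.1 x.2 : Fin (q + 1) → Fin N → ℝ)} := by
      have hc : Continuous fun x : (Fin N → ℝ) × (Fin q → Fin N → ℝ) =>
          (Fin.cons x.1 x.2 : Fin (q + 1) → Fin N → ℝ) := by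
        refine continuous_pi fun i => ?_
        refine Fin.cases ?_ (fun i => ?_) i
        · simpa using continuous_fst
        · exact (continuous_apply i).comp continuous_snd
      exact (isOpen_setOfPred_linearIndependent.preimage hc).measurableSet
    have hprod : ∀ᵐ x ∂(isoGaussian N 1).prod (gaussianMatrix q N),
        LinearIndependent ℝ (Fin.cons x.1 x.2 : Fin (q + 1) → Fin N → ℝ) := by
      rw [Measure.ae_prod_iff_ae_ae hms,
        Measure.ae_ae_comm (p := fun x y => LinearIndependent ℝ
          (Fin.cons x y : Fin (q + 1) → Fin N → ℝ)) hms]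
      filter_upwards [ih (by omega)] with W hW
      have hV : Submodule.span ℝ (Set.range W) ≠ ⊤ := by
        intro h
        have h1 := finrank_span_eq_card hW
        rw [h, finrank_top] at h1
        simp at h1
        omega
      filter_upwards [ae_notMem_submodule_isoGaussian _ hV] with x hx
      exact linearIndependent_finCons.2 ⟨hW, hx⟩
    have h := hmp.quasiMeasurePreserving.ae hprod
    filter_upwards [h] with W hW
    have : (Fin.cons (W 0) (fun i => W (Fin.succ i)) : Fin (q + 1) → Fin N → ℝ) = W :=
      Fin.cons_self_tail W
    rw [← this]
    exact hW

/-- `E exp (-t g² / 2) = (1 + t)^(-1/2)` for a standard Gaussian variable `g`. -/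
theorem integral_exp_neg_mul_sq_gaussianReal (t : ℝ) (ht : 0 ≤ t) :
    ∫ x, Real.exp (-(t / 2) * x ^ 2) ∂gaussianReal 0 1 = (1 + t) ^ (-(1 / 2) : ℝ) := by
  rw [integral_gaussianReal_eq_integral_smul (by norm_num)]
  have : ∀ x : ℝ, gaussianPDFReal 0 1 x • Real.exp (-(t / 2) * x ^ 2)
      = (√(2 * Real.pi))⁻¹ * Real.exp (-((1 + t) / 2) * x ^ 2) := by
    intro x
    rw [gaussianPDFReal]
    simp only [smul_eq_mul, NNReal.coe_one, mul_one, sub_zero]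
    rw [mul_assoc, ← Real.exp_add]
    ring_nf
  simp_rw [this]
  rw [integral_const_mul, integral_gaussian, Real.rpow_neg (by positivity), ← Real.sqrt_eq_rpow,
    ← Real.sqrt_inv, ← Real.sqrt_inv, ← Real.sqrt_mul (by positivity)]
  congr 1
  field_simp

/-- The representation of `1 / r` as a Laplace transform, through which the inverse moment of a
chi-square variable reduces to its Laplace transform; it is `⊤` at `r = 0`. -/
theorem lintegral_exp_neg_mul_Ioi (r : ℝ) (hr : 0 ≤ r) :
    ∫⁻ t in Set.Ioi (0 : ℝ), ENNReal.ofReal (Real.exp (-(t / 2) * r))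
      = 2 * (ENNReal.ofReal r)⁻¹ := by
  rcases hr.eq_or_lt with rfl | hr
  · simp
  · have h := integral_exp_mul_Ioi (a := -(r / 2)) (by linarith) 0
    have hi := integrableOn_exp_mul_Ioi (a := -(r / 2)) (by linarith) 0
    have e : ∀ t : ℝ, -(t / 2) * r = -(r / 2) * t := fun t => by ring
    simp_rw [e]
    rw [← ofReal_integral_eq_lintegral_ofReal hi (ae_of_all _ fun _ => (Real.exp_pos _).le), h,
      ← ENNReal.ofReal_inv_of_pos hr, ← ENNReal.ofReal_ofNat, ← ENNReal.ofReal_mul (by norm_num)]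
    congr 1
    simp
    field_simp

/-- The expectation of `1 / |g|²` for a standard Gaussian vector `g` of dimension `r`: by Tonelli's
theorem it is half the integral over `t > 0` of `E exp (-t |g|² / 2) = (1 + t)^(-r/2)`. -/
theorem lintegral_inv_normSq_isoGaussian (r : ℕ) :
    ∫⁻ z, (ENNReal.ofReal (z ⬝ᵥ z))⁻¹ ∂isoGaussian r 1
      = if 3 ≤ r then ENNReal.ofReal (1 / ((r : ℝ) - 2)) else ⊤ := by
  have h2 : ∫⁻ z, 2 * (ENNReal.ofReal (z ⬝ᵥ z))⁻¹ ∂isoGaussian r 1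
      = ∫⁻ t in Set.Ioi (0 : ℝ), ENNReal.ofReal ((1 + t) ^ (-(r / 2) : ℝ)) := by
    calc _ = ∫⁻ z, (∫⁻ t in Set.Ioi (0 : ℝ), ENNReal.ofReal (Real.exp (-(t / 2) * (z ⬝ᵥ z))))
            ∂isoGaussian r 1 := by
          refine lintegral_congr fun z => (lintegral_exp_neg_mul_Ioi _ ?_).symm
          exact sqNorm_nonneg z
      _ = ∫⁻ t in Set.Ioi (0 : ℝ), ∫⁻ z, ENNReal.ofReal (Real.exp (-(t / 2) * (z ⬝ᵥ z)))
            ∂isoGaussian r 1 := by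
          refine lintegral_lintegral_swap ?_
          unfold dotProduct
          exact Measurable.aemeasurable (by fun_prop)
      _ = _ := by
          refine setLIntegral_congr_fun measurableSet_Ioi fun t ht => ?_
          have ht : 0 < t := ht
          have hb : ∀ z : Fin r → ℝ, Real.exp (-(t / 2) * (z ⬝ᵥ z))
              = ∏ i, Real.exp (-(t / 2) * z i ^ 2) := by
            intro z
            rw [← Real.exp_sum, dotProduct, Finset.mul_sum]
            simp [sq]
          simp only [hb]
          rw [← ofReal_integral_eq_lintegral_ofReal, isoGaussian, Real.toNNReal_one,
            integral_fintype_prod_eq_prod (f := fun _ x => Real.exp (-(t / 2) * x ^ 2)),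
            integral_exp_neg_mul_sq_gaussianReal t ht.le]
          · congr 1
            simp only [Finset.prod_const, Finset.card_univ, Fintype.card_fin]
            rw [← Real.rpow_natCast, ← Real.rpow_mul (by positivity)]
            congr 1; ring
          · refine Integrable.of_bound (C := 1) ?_ (ae_of_all _ fun z => ?_)
            · exact Measurable.aestronglyMeasurable (by fun_prop)
            · rw [← hb, Real.norm_eq_abs, abs_of_pos (Real.exp_pos _), Real.exp_le_one_iff]
              have := sqNorm_nonneg z
              unfold sqNorm at this
              have : 0 ≤ t / 2 * (z ⬝ᵥ z) := by positivity
              linarith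
          · exact ae_of_all _ fun z => Finset.prod_nonneg fun _ _ => (Real.exp_pos _).le
  have h3 : ∫⁻ t in Set.Ioi (0 : ℝ), ENNReal.ofReal ((1 + t) ^ (-(r / 2) : ℝ))
      = ∫⁻ t in Set.Ioi (1 : ℝ), ENNReal.ofReal (t ^ (-(r / 2) : ℝ)) := by
    have := (measurePreserving_add_left volume (1 : ℝ)).setLIntegral_comp_preimage_emb
      (measurableEmbedding_addLeft (1 : ℝ))
      (fun t => ENNReal.ofReal (t ^ (-(r / 2) : ℝ))) (Set.Ioi 1)
    rw [← this]
    congr 2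
    simp
  rw [h3, lintegral_const_mul _ (by unfold dotProduct; fun_prop)] at h2
  split_ifs with hr
  · have hr' : (3 : ℝ) ≤ r := by exact_mod_cast hr
    rw [← ofReal_integral_eq_lintegral_ofReal
      (integrableOn_Ioi_rpow_of_lt (by linarith) one_pos), integral_Ioi_rpow_of_lt (by linarith)
      one_pos] at h2
    · have h5 : ENNReal.ofReal (-1 ^ (-((r : ℝ) / 2) + 1) / (-((r : ℝ) / 2) + 1))
          = 2 * ENNReal.ofReal (1 / ((r : ℝ) - 2)) := by
        rw [← ENNReal.ofReal_ofNat, ← ENNReal.ofReal_mul (by norm_num), Real.one_rpow]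
        congr 1
        have h6 : (r : ℝ) - 2 ≠ 0 := by linarith
        have h7 : (-((r : ℝ) / 2) + 1) = -(((r : ℝ) - 2) / 2) := by ring
        rw [h7]
        field_simp
      rw [h5] at h2
      exact (ENNReal.mul_right_inj (by norm_num) (by norm_num)).1 h2
    · refine (ae_restrict_iff' measurableSet_Ioi).2 (ae_of_all _ fun t ht => ?_)
      exact Real.rpow_nonneg (zero_le_one.trans (le_of_lt ht)) _
  · have hr' : (r : ℝ) ≤ 2 := by exact_mod_cast (by omega : r ≤ 2)
    have htop : ∫⁻ t in Set.Ioi (1 : ℝ), ENNReal.ofReal (t ^ (-(r / 2) : ℝ)) = ⊤ := by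
      by_contra hne
      have hni : ¬ IntegrableOn (fun t : ℝ => t ^ (-(r / 2) : ℝ)) (Set.Ioi 1) := by
        rw [integrableOn_Ioi_rpow_iff one_pos]; linarith
      apply hni
      have hnn : 0 ≤ᵐ[volume.restrict (Set.Ioi (1 : ℝ))] fun t : ℝ => t ^ (-(r / 2) : ℝ) := by
        refine (ae_restrict_iff' measurableSet_Ioi).2 (ae_of_all _ fun t ht => ?_)
        exact Real.rpow_nonneg (zero_le_one.trans (le_of_lt ht)) _
      exact (lintegral_ofReal_ne_top_iff_integrable
        (Measurable.aestronglyMeasurable (by fun_prop)) hnn).1 hne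
    rw [htop] at h2
    by_contra hne
    exact (ENNReal.mul_ne_top (by norm_num) hne) h2

/-! ### Inverse moments of Gaussian Gram matrices -/

theorem measurable_matrix_det {Ω : Type*} [MeasurableSpace Ω] {q : ℕ}
    {A : Ω → Matrix (Fin q) (Fin q) ℝ} (hA : ∀ i j, Measurable fun ω => A ω i j) :
    Measurable fun ω => (A ω).det := by
  simp only [Matrix.det_apply]
  exact Finset.measurable_sum _ fun σ _ =>
    (Finset.measurable_prod _ fun i _ => hA _ _).const_smul _

theorem measurable_matrix_inv {Ω : Type*} [MeasurableSpace Ω] {q : ℕ}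
    {A : Ω → Matrix (Fin q) (Fin q) ℝ} (hA : ∀ i j, Measurable fun ω => A ω i j) (i j : Fin q) :
    Measurable fun ω => (A ω)⁻¹ i j := by
  simp only [Matrix.inv_def, Ring.inverse_eq_inv', Matrix.smul_apply, Matrix.adjugate_apply,
    smul_eq_mul]
  refine (measurable_matrix_det hA).inv.mul (measurable_matrix_det fun k l => ?_)
  simp only [Matrix.updateRow_apply]
  split_ifs
  · exact measurable_const
  · exact hA k l

theorem measurable_matrix_mul {Ω : Type*} [MeasurableSpace Ω] {p q r : ℕ}
    {A : Ω → Matrix (Fin p) (Fin q) ℝ} {B : Ω → Matrix (Fin q) (Fin r) ℝ}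
    (hA : ∀ i j, Measurable fun ω => A ω i j) (hB : ∀ i j, Measurable fun ω => B ω i j)
    (i : Fin p) (j : Fin r) : Measurable fun ω => (A ω * B ω) i j := by
  simp only [Matrix.mul_apply]
  exact Finset.measurable_sum _ fun k _ => (hA i k).mul (hB k j)

theorem isUnit_gram_of_linearIndependent {q N : ℕ} {W : Fin q → Fin N → ℝ}
    (hW : LinearIndependent ℝ W) : IsUnit (Matrix.of W * (Matrix.of W)ᵀ) := by
  have h : Function.Injective (Matrix.of W).vecMul := Matrix.vecMul_injective_iff.2 hW
  exact (Matrix.PosDef.mul_conjTranspose_self (Matrix.of W) h).isUnit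

/-- A diagonal entry of the inverse of the Gram matrix of the rows of `W` is the inverse squared
distance from that row to the span of the other rows; here `v` is an orthonormal basis of the
orthogonal complement of that span. -/
theorem inv_gram_apply_self_mul {q N r : ℕ} (k : Fin (q + 1)) (x : Fin N → ℝ)
    (W : Fin q → Fin N → ℝ) (hx : LinearIndependent ℝ (k.insertNth x W : Fin (q + 1) → Fin N → ℝ))
    (V : Submodule ℝ (EuclideanSpace ℝ (Fin N)))
    (hV : V = Submodule.span ℝ (Set.range fun i => WithLp.toLp 2 (W i)))
    (v : OrthonormalBasis (Fin r) ℝ Vᗮ) :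
    (Matrix.of (k.insertNth x W : Fin (q + 1) → Fin N → ℝ)
      * (Matrix.of (k.insertNth x W : Fin (q + 1) → Fin N → ℝ))ᵀ)⁻¹ k k *
      ((fun i => (v i : EuclideanSpace ℝ (Fin N)).ofLp ⬝ᵥ x) ⬝ᵥ
        (fun i => (v i : EuclideanSpace ℝ (Fin N)).ofLp ⬝ᵥ x)) = 1 := by
  set U : Fin (q + 1) → Fin N → ℝ := k.insertNth x W with hU
  set G := Matrix.of U * (Matrix.of U)ᵀ with hG
  have hGu : IsUnit G.det := (Matrix.isUnit_iff_isUnit_det _).1 (isUnit_gram_of_linearIndependent hx)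
  -- `a` is dual to row `k`: orthogonal to the other rows, with inner product `1` with `x`
  set a : Fin N → ℝ := fun t => ∑ l, G⁻¹ k l * U l t with ha
  have hdot : ∀ l, a ⬝ᵥ U l = (1 : Matrix (Fin (q + 1)) (Fin (q + 1)) ℝ) k l := by
    intro l
    rw [← Matrix.nonsing_inv_mul G hGu, Matrix.mul_apply]
    simp only [ha, dotProduct, Finset.sum_mul, hG, Matrix.mul_apply, Matrix.of_apply,
      Matrix.transpose_apply, Finset.mul_sum]
    rw [Finset.sum_comm]
    simp only [mul_assoc]
  have haV : WithLp.toLp 2 a ∈ Vᗮ := by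
    rw [hV, Submodule.mem_orthogonal]
    intro u hu
    induction hu using Submodule.span_induction with
    | mem u hu =>
      obtain ⟨i, rfl⟩ := hu
      have := hdot (k.succAbove i)
      rw [hU, Fin.insertNth_apply_succAbove, Matrix.one_apply_ne (Fin.succAbove_ne k i).symm] at this
      rw [← this]
      simp [PiLp.inner_apply, dotProduct]
    | zero => simp
    | add u w _ _ h1 h2 => rw [inner_add_left, h1, h2, add_zero]
    | smul c u _ h => rw [inner_smul_left, h, mul_zero]
  have hva : ∀ i, (v i : EuclideanSpace ℝ (Fin N)).ofLp ⬝ᵥ a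
      = G⁻¹ k k * ((v i : EuclideanSpace ℝ (Fin N)).ofLp ⬝ᵥ x) := by
    intro i
    have h1 : (v i : EuclideanSpace ℝ (Fin N)).ofLp ⬝ᵥ a
        = ∑ l, G⁻¹ k l * ((v i : EuclideanSpace ℝ (Fin N)).ofLp ⬝ᵥ U l) := by
      simp only [ha, dotProduct, Finset.mul_sum]
      rw [Finset.sum_comm]
      refine Finset.sum_congr rfl fun _ _ => Finset.sum_congr rfl fun _ _ => by ring
    rw [h1, Fin.sum_univ_succAbove _ k]
    have h2 : ∀ j, (v i : EuclideanSpace ℝ (Fin N)).ofLp ⬝ᵥ U (k.succAbove j) = 0 := by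
      intro j
      have := (Submodule.mem_orthogonal _ _).1 (v i).2 (WithLp.toLp 2 (W j))
        (hV ▸ Submodule.subset_span ⟨j, rfl⟩)
      rw [← this, hU, Fin.insertNth_apply_succAbove]
      simp [PiLp.inner_apply, dotProduct, mul_comm]
    simp only [h2, mul_zero, Finset.sum_const_zero, add_zero]
    rw [hU, Fin.insertNth_apply_same]
  have hsum := congrArg (fun u : Vᗮ => (u : EuclideanSpace ℝ (Fin N)).ofLp ⬝ᵥ x)
    (v.sum_repr' ⟨WithLp.toLp 2 a, haV⟩)
  have hax : a ⬝ᵥ x = 1 := by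
    have := hdot k
    rwa [hU, Fin.insertNth_apply_same, Matrix.one_apply_eq] at this
  rw [← hax]
  refine Eq.trans ?_ hsum
  have hinner : ∀ i, inner ℝ (v i) (⟨WithLp.toLp 2 a, haV⟩ : Vᗮ)
      = (v i : EuclideanSpace ℝ (Fin N)).ofLp ⬝ᵥ a := by
    intro i
    rw [Submodule.coe_inner]
    simp [PiLp.inner_apply, dotProduct, mul_comm]
  simp only [hinner, hva]
  simp only [Submodule.coe_sum, Submodule.coe_smul, WithLp.ofLp_sum, WithLp.ofLp_smul,
    sum_dotProduct, smul_dotProduct, smul_eq_mul]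
  rw [dotProduct, Finset.mul_sum]
  exact Finset.sum_congr rfl fun i _ => by ring

theorem measurable_inv_gram_apply_self {q N : ℕ} (k : Fin q) :
    Measurable fun W : Fin q → Fin N → ℝ =>
      ENNReal.ofReal ((Matrix.of W * (Matrix.of W)ᵀ)⁻¹ k k) := by
  refine ENNReal.measurable_ofReal.comp (measurable_matrix_inv (fun i j => ?_) k k)
  refine measurable_matrix_mul (fun i j => ?_) (fun i j => ?_) i j
  · simp only [Matrix.of_apply]; fun_prop
  · simp only [Matrix.of_apply, Matrix.transpose_apply]; fun_prop

theorem measurable_trace_inv_gram {q N : ℕ} :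
    Measurable fun W : Fin q → Fin N → ℝ =>
      ENNReal.ofReal (Matrix.trace (Matrix.of W * (Matrix.of W)ᵀ)⁻¹) := by
  refine ENNReal.measurable_ofReal.comp (Finset.measurable_sum _ fun k _ => ?_)
  refine measurable_matrix_inv (fun i j => measurable_matrix_mul (fun i j => ?_) (fun i j => ?_) i j) k k
  · simp only [Matrix.of_apply]; fun_prop
  · simp only [Matrix.of_apply, Matrix.transpose_apply]; fun_prop

/-- A diagonal entry of an inverse Wishart matrix is distributed as the inverse of a chi-square
variable with `N - q` degrees of freedom. -/
theorem lintegral_inv_gram_apply_self {q N : ℕ} (hq : q + 1 ≤ N) (k : Fin (q + 1)) :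
    ∫⁻ W, ENNReal.ofReal ((Matrix.of W * (Matrix.of W)ᵀ)⁻¹ k k) ∂gaussianMatrix (q + 1) N
      = if q + 3 ≤ N then ENNReal.ofReal (1 / ((N : ℝ) - q - 2)) else ⊤ := by
  have hmp := (measurePreserving_piFinSuccAbove (fun _ : Fin (q + 1) => isoGaussian N 1) k).symm
  have hmeas := measurable_inv_gram_apply_self (N := N) k
  rw [gaussianMatrix, ← hmp.lintegral_comp hmeas, lintegral_prod_symm]
  swap
  · exact (hmeas.comp (MeasurableEquiv.measurable _)).aemeasurable
  rw [← mul_one (ite _ _ _), ← measure_univ (μ := gaussianMatrix q N), ← lintegral_const]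
  refine lintegral_congr_ae ?_
  have hae := Measure.ae_ae_of_ae_prod (Measure.measurePreserving_swap.quasiMeasurePreserving.ae
    (hmp.quasiMeasurePreserving.ae (linearIndependent_gaussianMatrix hq)))
  filter_upwards [linearIndependent_gaussianMatrix (by omega : q ≤ N), hae] with W hW hWx
  set V : Submodule ℝ (EuclideanSpace ℝ (Fin N)) :=
    Submodule.span ℝ (Set.range fun i => WithLp.toLp 2 (W i)) with hV
  have hW' : LinearIndependent ℝ fun i => WithLp.toLp 2 (W i) :=
    hW.map' (WithLp.linearEquiv 2 ℝ (Fin N → ℝ)).symm.toLinearMap (LinearEquiv.ker _)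
  have hrank : Module.finrank ℝ Vᗮ = N - q := by
    have h1 := V.finrank_add_finrank_orthogonal
    have h2 : Module.finrank ℝ V = q := by rw [hV, finrank_span_eq_card hW', Fintype.card_fin]
    rw [h2, finrank_euclideanSpace_fin] at h1
    omega
  let v : OrthonormalBasis (Fin (N - q)) ℝ Vᗮ :=
    (stdOrthonormalBasis ℝ Vᗮ).reindex (finCongr hrank)
  have hon : Orthonormal ℝ fun i => (v i : EuclideanSpace ℝ (Fin N)) :=
    v.orthonormal.comp_linearIsometry Vᗮ.subtypeₗᵢ
  have hinv : ∫⁻ x, (ENNReal.ofReal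
      ((fun i => (v i : EuclideanSpace ℝ (Fin N)).ofLp ⬝ᵥ x) ⬝ᵥ
        (fun i => (v i : EuclideanSpace ℝ (Fin N)).ofLp ⬝ᵥ x)))⁻¹ ∂isoGaussian N 1
      = if q + 3 ≤ N then ENNReal.ofReal (1 / ((N : ℝ) - q - 2)) else ⊤ := by
    have := (measurePreserving_inner_orthonormal _ hon).lintegral_comp
      (f := fun z => (ENNReal.ofReal (z ⬝ᵥ z))⁻¹) (by unfold dotProduct; fun_prop)
    rw [this, lintegral_inv_normSq_isoGaussian]
    have e : 3 ≤ N - q ↔ q + 3 ≤ N := by omega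
    simp only [e]
    rw [Nat.cast_sub (by omega)]
  rw [← hinv]
  refine lintegral_congr_ae ?_
  filter_upwards [hWx] with x hLI
  have h := inv_gram_apply_self_mul k x W hLI V hV v
  set s := ((fun i => (v i : EuclideanSpace ℝ (Fin N)).ofLp ⬝ᵥ x) ⬝ᵥ
        (fun i => (v i : EuclideanSpace ℝ (Fin N)).ofLp ⬝ᵥ x)) with hs
  have hs0 : 0 ≤ s := sqNorm_nonneg _
  have hs1 : 0 < s := hs0.lt_of_ne fun h0 => by rw [← h0] at h; simp at h
  rw [← ENNReal.ofReal_inv_of_pos hs1]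
  congr 1
  exact eq_inv_of_mul_eq_one_left h

/-- The expected trace of an inverse Wishart matrix. -/
theorem lintegral_trace_inv_gram {q N : ℕ} (hq0 : 0 < q) (hq : q ≤ N) :
    ∫⁻ W, ENNReal.ofReal (Matrix.trace (Matrix.of W * (Matrix.of W)ᵀ)⁻¹) ∂gaussianMatrix q N
      = if q + 2 ≤ N then ENNReal.ofReal (q / ((N : ℝ) - q - 1)) else ⊤ := by
  obtain ⟨q, rfl⟩ : ∃ q', q = q' + 1 := ⟨q - 1, by omega⟩
  have h1 : ∀ W : Fin (q + 1) → Fin N → ℝ,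
      ENNReal.ofReal (Matrix.trace (Matrix.of W * (Matrix.of W)ᵀ)⁻¹)
        = ∑ k, ENNReal.ofReal ((Matrix.of W * (Matrix.of W)ᵀ)⁻¹ k k) := by
    intro W
    rw [Matrix.trace, ENNReal.ofReal_sum_of_nonneg]
    · rfl
    · intro k _
      exact (Matrix.posSemidef_self_mul_conjTranspose (Matrix.of W)).inv.diag_nonneg
  simp_rw [h1]
  rw [lintegral_finsetSum]
  · simp only [lintegral_inv_gram_apply_self hq, Finset.sum_const, Finset.card_univ,
      Fintype.card_fin, nsmul_eq_mul]
    have e : q + 1 + 2 ≤ N ↔ q + 3 ≤ N := by omega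
    simp only [e]
    split_ifs with h
    · rw [← ENNReal.ofReal_natCast, ← ENNReal.ofReal_mul (by positivity)]
      congr 1
      push_cast
      rw [mul_one_div]
      congr 1
      ring
    · rw [ENNReal.mul_top (by simp)]
  · intro k _
    exact measurable_inv_gram_apply_self k

/-! ### The pseudoinverse of a Gaussian matrix -/

theorem pinv_eq_of_isUnit_transpose_mul {p d : ℕ} (Z : Matrix (Fin p) (Fin d) ℝ)
    (hZ : IsUnit (Zᵀ * Z)) : pinv Z = (Zᵀ * Z)⁻¹ * Zᵀ := by
  obtain ⟨G, hG, -, h1, -, -⟩ := exists_pinv_eq Z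
  have hdet := (Matrix.isUnit_iff_isUnit_det _).1 hZ
  have h2 : (Zᵀ * Z) * G = 1 := by
    have := congrArg (fun A => A * (Zᵀ * Z)⁻¹) h1
    simpa [Matrix.mul_assoc, Matrix.mul_nonsing_inv _ hdet] using this
  rw [hG, Matrix.inv_eq_right_inv h2]

theorem pinv_eq_of_isUnit_mul_transpose {p d : ℕ} (Z : Matrix (Fin p) (Fin d) ℝ)
    (hZ : IsUnit (Z * Zᵀ)) : pinv Z = Zᵀ * (Z * Zᵀ)⁻¹ := by
  have hdet := (Matrix.isUnit_iff_isUnit_det _).1 hZ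
  have h1 : Z * pinv Z = 1 := by
    have := congrArg (fun A => A * Zᵀ * (Z * Zᵀ)⁻¹) (mul_pinv_mul Z)
    simp only [Matrix.mul_assoc] at this
    rwa [← Matrix.mul_assoc Z Zᵀ, Matrix.mul_nonsing_inv _ hdet, Matrix.mul_one] at this
  have h2 : pinv Z = Zᵀ * ((pinv Z)ᵀ * pinv Z) := by
    rw [← Matrix.mul_assoc, ← Matrix.transpose_mul, pinv_mul_symm, pinv_mul_pinv]
  have h3 : (Z * Zᵀ) * ((pinv Z)ᵀ * pinv Z) = 1 := by
    rw [Matrix.mul_assoc, ← h2, h1]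
  rw [Matrix.inv_eq_right_inv h3, ← h2]

/-- The formula for the pseudoinverse of a matrix of full rank, which, unlike `pinv`, is visibly a
measurable function of the matrix. -/
def fullRankPinv {p d : ℕ} (Z : Matrix (Fin p) (Fin d) ℝ) : Matrix (Fin d) (Fin p) ℝ :=
  if d ≤ p then (Zᵀ * Z)⁻¹ * Zᵀ else Zᵀ * (Z * Zᵀ)⁻¹

theorem measurable_fullRankPinv {p d : ℕ} (i : Fin d) (j : Fin p) :
    Measurable fun Z : Fin p → Fin d → ℝ => fullRankPinv (Matrix.of Z) i j := by
  have h1 : ∀ i j, Measurable fun Z : Fin p → Fin d → ℝ => Matrix.of Z i j := by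
    intro i j; simp only [Matrix.of_apply]; fun_prop
  have h2 : ∀ i j, Measurable fun Z : Fin p → Fin d → ℝ => (Matrix.of Z)ᵀ i j :=
    fun i j => h1 j i
  unfold fullRankPinv
  split_ifs
  · exact measurable_matrix_mul (measurable_matrix_inv (measurable_matrix_mul h2 h1)) h2 i j
  · exact measurable_matrix_mul h2 (measurable_matrix_inv (measurable_matrix_mul h1 h2)) i j

theorem ae_isUnit_transpose_mul {p d : ℕ} (h : d ≤ p) :
    ∀ᵐ Z ∂gaussianMatrix p d, IsUnit ((Matrix.of Z)ᵀ * Matrix.of Z) := by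
  filter_upwards [(measurePreserving_transpose_gaussianMatrix p d).quasiMeasurePreserving.ae
    (linearIndependent_gaussianMatrix h)] with Z hZ
  exact isUnit_gram_of_linearIndependent hZ

theorem ae_isUnit_mul_transpose {p d : ℕ} (h : p ≤ d) :
    ∀ᵐ Z ∂gaussianMatrix p d, IsUnit (Matrix.of Z * (Matrix.of Z)ᵀ) := by
  filter_upwards [linearIndependent_gaussianMatrix h] with Z hZ
  exact isUnit_gram_of_linearIndependent hZ

theorem ae_pinv_eq_fullRankPinv (p d : ℕ) :
    ∀ᵐ Z ∂gaussianMatrix p d, pinv (Matrix.of Z) = fullRankPinv (Matrix.of Z) := by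
  unfold fullRankPinv
  split_ifs with h
  · filter_upwards [ae_isUnit_transpose_mul h] with Z hZ
    exact pinv_eq_of_isUnit_transpose_mul _ hZ
  · filter_upwards [ae_isUnit_mul_transpose (not_le.1 h).le] with Z hZ
    exact pinv_eq_of_isUnit_mul_transpose _ hZ

theorem fullRankPinv_mul_orthogonal {p d : ℕ} (Z : Matrix (Fin p) (Fin d) ℝ)
    (Q : Matrix (Fin d) (Fin d) ℝ) (hQ : Qᵀ * Q = 1) :
    fullRankPinv (Z * Q) = Qᵀ * fullRankPinv Z := by
  have hQ' : Q * Qᵀ = 1 := mul_eq_one_comm.1 hQ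
  have hi : Q⁻¹ = Qᵀ := Matrix.inv_eq_left_inv hQ
  have hi' : Qᵀ⁻¹ = Q := Matrix.inv_eq_left_inv hQ'
  unfold fullRankPinv
  split_ifs
  · have e : (Z * Q)ᵀ * (Z * Q) = Qᵀ * ((Zᵀ * Z) * Q) := by
      simp only [Matrix.transpose_mul, Matrix.mul_assoc]
    rw [e, Matrix.mul_inv_rev, Matrix.mul_inv_rev, hi, hi', Matrix.transpose_mul]
    simp only [Matrix.mul_assoc]
    rw [← Matrix.mul_assoc Q Qᵀ, hQ', Matrix.one_mul]
  · have e : (Z * Q) * (Z * Q)ᵀ = Z * Zᵀ := by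
      rw [Matrix.transpose_mul, Matrix.mul_assoc, ← Matrix.mul_assoc Q, hQ', Matrix.one_mul]
    rw [e, Matrix.transpose_mul, Matrix.mul_assoc]

theorem measurePreserving_mul_orthogonal {p d : ℕ} (Q : Matrix (Fin d) (Fin d) ℝ)
    (hQ : Qᵀ * Q = 1) :
    MeasurePreserving (fun (Z : Fin p → Fin d → ℝ) i j => (Matrix.of Z * Q) i j)
      (gaussianMatrix p d) (gaussianMatrix p d) := by
  have hon : Orthonormal ℝ fun j => WithLp.toLp 2 (Qᵀ j) := by
    rw [orthonormal_iff_ite]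
    intro i j
    have := congrFun (congrFun hQ j) i
    rw [Matrix.mul_apply, Matrix.one_apply] at this
    simp only [PiLp.inner_apply, Matrix.transpose_apply] at this ⊢
    simp only [RCLike.inner_apply, conj_trivial]
    rw [this]
    simp [eq_comm]
  have h := measurePreserving_pi (fun _ : Fin p => isoGaussian d 1) (fun _ => isoGaussian d 1)
    (fun _ => measurePreserving_inner_orthonormal _ hon)
  have e : (fun (Z : Fin p → Fin d → ℝ) i j => (Matrix.of Z * Q) i j)
      = fun Z i j => (WithLp.toLp 2 (Qᵀ j)).ofLp ⬝ᵥ Z i := by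
    ext Z i j
    simp [Matrix.mul_apply, dotProduct, mul_comm]
  rw [e]
  exact h

/-! ### Entrywise means of random matrices -/

/-- The random matrix `F` is integrable with mean `M`, entry by entry. -/
def HasMean {Ω : Type*} [MeasurableSpace Ω] (μ : Measure Ω) {p q : ℕ}
    (F : Ω → Matrix (Fin p) (Fin q) ℝ) (M : Matrix (Fin p) (Fin q) ℝ) : Prop :=
  ∀ i j, Integrable (fun ω => F ω i j) μ ∧ ∫ ω, F ω i j ∂μ = M i j

namespace HasMean

variable {Ω : Type*} [MeasurableSpace Ω] {μ : Measure Ω} {p q r : ℕ}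

theorem congr {F G : Ω → Matrix (Fin p) (Fin q) ℝ} {M : Matrix (Fin p) (Fin q) ℝ}
    (h : HasMean μ F M) (hFG : ∀ᵐ ω ∂μ, F ω = G ω) : HasMean μ G M := fun i j =>
  have e : (fun ω => F ω i j) =ᵐ[μ] fun ω => G ω i j := hFG.mono fun ω hω => by simp only [hω]
  ⟨(h i j).1.congr e, by rw [← integral_congr_ae e, (h i j).2]⟩

theorem const [IsProbabilityMeasure μ] (M : Matrix (Fin p) (Fin q) ℝ) :
    HasMean μ (fun _ => M) M := fun _ _ => ⟨integrable_const _, by simp⟩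

theorem sub {F G : Ω → Matrix (Fin p) (Fin q) ℝ} {M N : Matrix (Fin p) (Fin q) ℝ}
    (hF : HasMean μ F M) (hG : HasMean μ G N) : HasMean μ (fun ω => F ω - G ω) (M - N) :=
  fun i j => ⟨(hF i j).1.sub (hG i j).1, by
    simp only [Matrix.sub_apply]
    rw [integral_sub (hF i j).1 (hG i j).1, (hF i j).2, (hG i j).2]⟩

theorem smul {F : Ω → Matrix (Fin p) (Fin q) ℝ} {M : Matrix (Fin p) (Fin q) ℝ} (c : ℝ)
    (hF : HasMean μ F M) : HasMean μ (fun ω => c • F ω) (c • M) :=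
  fun i j => ⟨(hF i j).1.const_mul c, by
    simp only [Matrix.smul_apply, smul_eq_mul]
    rw [integral_const_mul, (hF i j).2]⟩

theorem sum {ι : Type*} (s : Finset ι) {F : ι → Ω → Matrix (Fin p) (Fin q) ℝ}
    {M : ι → Matrix (Fin p) (Fin q) ℝ} (hF : ∀ k ∈ s, HasMean μ (F k) (M k)) :
    HasMean μ (fun ω => ∑ k ∈ s, F k ω) (∑ k ∈ s, M k) := fun i j => by
  simp only [Matrix.sum_apply]
  refine ⟨integrable_finsetSum _ fun k hk => (hF k hk i j).1, ?_⟩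
  rw [integral_finsetSum _ fun k hk => (hF k hk i j).1]
  exact Finset.sum_congr rfl fun k hk => (hF k hk i j).2

theorem const_mul {F : Ω → Matrix (Fin p) (Fin q) ℝ} {M : Matrix (Fin p) (Fin q) ℝ}
    (A : Matrix (Fin r) (Fin p) ℝ) (hF : HasMean μ F M) : HasMean μ (fun ω => A * F ω) (A * M) :=
  fun i j => by
    simp only [Matrix.mul_apply]
    refine ⟨integrable_finsetSum _ fun k _ => (hF k j).1.const_mul _, ?_⟩
    rw [integral_finsetSum _ fun k _ => (hF k j).1.const_mul _]
    exact Finset.sum_congr rfl fun k _ => by rw [integral_const_mul, (hF k j).2]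

theorem mul_const {F : Ω → Matrix (Fin p) (Fin q) ℝ} {M : Matrix (Fin p) (Fin q) ℝ}
    (A : Matrix (Fin q) (Fin r) ℝ) (hF : HasMean μ F M) : HasMean μ (fun ω => F ω * A) (M * A) :=
  fun i j => by
    simp only [Matrix.mul_apply]
    refine ⟨integrable_finsetSum _ fun k _ => (hF i k).1.mul_const _, ?_⟩
    rw [integral_finsetSum _ fun k _ => (hF i k).1.mul_const _]
    exact Finset.sum_congr rfl fun k _ => by rw [integral_mul_const, (hF i k).2]

theorem integrable_trace {F : Ω → Matrix (Fin p) (Fin p) ℝ} {M : Matrix (Fin p) (Fin p) ℝ}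
    (hF : HasMean μ F M) : Integrable (fun ω => (F ω).trace) μ :=
  integrable_finsetSum _ fun k _ => (hF k k).1

theorem integral_trace {F : Ω → Matrix (Fin p) (Fin p) ℝ} {M : Matrix (Fin p) (Fin p) ℝ}
    (hF : HasMean μ F M) : ∫ ω, (F ω).trace ∂μ = M.trace := by
  simp only [Matrix.trace, Matrix.diag_apply]
  rw [integral_finsetSum _ fun k _ => (hF k k).1]
  exact Finset.sum_congr rfl fun k _ => (hF k k).2

theorem comp_measurePreserving {Ω' : Type*} [MeasurableSpace Ω'] {ν : Measure Ω'} {f : Ω' → Ω}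
    {F : Ω → Matrix (Fin p) (Fin q) ℝ} {M : Matrix (Fin p) (Fin q) ℝ}
    (hF : HasMean μ F M) (hf : MeasurePreserving f ν μ) : HasMean ν (fun ω => F (f ω)) M :=
  fun i j => ⟨hf.integrable_comp_of_integrable (hF i j).1, by
    rw [← (hF i j).2, ← hf.map_eq, integral_map hf.measurable.aemeasurable]
    rw [hf.map_eq]
    exact (hF i j).1.aestronglyMeasurable⟩

end HasMean

/-- A function of a Gaussian matrix that transforms by conjugation when the matrix is multiplied by
an orthogonal matrix has a scalar mean: reflecting one coordinate kills the off-diagonal entries and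
exchanging two coordinates identifies the diagonal ones. -/
theorem hasMean_of_orthogonal_equivariant {p d : ℕ} (hd : 0 < d)
    {F : (Fin p → Fin d → ℝ) → Matrix (Fin d) (Fin d) ℝ}
    (hint : ∀ i j, Integrable (fun Z => F Z i j) (gaussianMatrix p d))
    (heq : ∀ Q : Matrix (Fin d) (Fin d) ℝ, Qᵀ * Q = 1 → ∀ Z : Fin p → Fin d → ℝ,
      F (fun i j => (Matrix.of Z * Q) i j) = Qᵀ * F Z * Q)
    {t : ℝ} (ht : ∫ Z, (F Z).trace ∂gaussianMatrix p d = t) :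
    HasMean (gaussianMatrix p d) F ((t / d) • 1) := by
  set M : Matrix (Fin d) (Fin d) ℝ := Matrix.of fun i j => ∫ Z, F Z i j ∂gaussianMatrix p d with hM
  have hF : HasMean (gaussianMatrix p d) F M := fun i j => ⟨hint i j, rfl⟩
  have hinv : ∀ Q : Matrix (Fin d) (Fin d) ℝ, Qᵀ * Q = 1 → M = Qᵀ * M * Q := by
    intro Q hQ
    have h1 := hF.comp_measurePreserving (measurePreserving_mul_orthogonal Q hQ)
    have h2 := (hF.const_mul Qᵀ).mul_const Q
    ext i j
    rw [← (h1 i j).2, ← (h2 i j).2]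
    simp only [heq Q hQ]
  have hoff : ∀ k l, k ≠ l → M k l = 0 := by
    intro k l hkl
    have := hinv (Matrix.diagonal fun i => if i = k then -1 else 1) (by
      rw [Matrix.diagonal_transpose, Matrix.diagonal_mul_diagonal, ← Matrix.diagonal_one]
      congr 1; ext i; split_ifs <;> simp)
    have := congrFun (congrFun this k) l
    rw [Matrix.diagonal_transpose, Matrix.mul_diagonal, Matrix.diagonal_mul] at this
    simp [hkl.symm] at this
    linarith
  have hdiag : ∀ k l, M k k = M l l := by
    intro k l
    have := hinv (Matrix.of fun i j => if i = Equiv.swap k l j then 1 else 0) (by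
      ext i j
      simp only [Matrix.mul_apply, Matrix.one_apply, Matrix.transpose_apply, Matrix.of_apply,
        ite_mul, one_mul, zero_mul, Finset.sum_ite_eq', Finset.mem_univ, if_true,
        EmbeddingLike.apply_eq_iff_eq])
    have := congrFun (congrFun this k) k
    simpa [Matrix.mul_apply] using this
  have htr : M.trace = t := by rw [← hF.integral_trace, ht]
  have : M = (t / d) • (1 : Matrix (Fin d) (Fin d) ℝ) := by
    ext i j
    by_cases hij : i = j
    · subst hij
      have h1 : M.trace = d * M i i := by
        rw [Matrix.trace]
        simp [Matrix.diag_apply, hdiag _ i]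
      have : (d : ℝ) ≠ 0 := by positivity
      simp only [Matrix.smul_apply, Matrix.one_apply_eq, smul_eq_mul, mul_one]
      rw [← htr, h1]
      field_simp
    · simp [hoff i j hij, Matrix.one_apply_ne hij]
  rw [← this]
  exact hF

/-- The entries of a random orthogonal projection are bounded by `1`. -/
theorem integrable_of_idempotent {Ω : Type*} [MeasurableSpace Ω] {μ : Measure Ω}
    [IsFiniteMeasure μ] {d : ℕ} {F : Ω → Matrix (Fin d) (Fin d) ℝ}
    (hm : ∀ i j, Measurable fun ω => F ω i j) (hs : ∀ᵐ ω ∂μ, (F ω)ᵀ = F ω ∧ F ω * F ω = F ω)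
    (i j : Fin d) : Integrable (fun ω => F ω i j) μ := by
  refine Integrable.of_bound (C := 1) (hm i j).aestronglyMeasurable ?_
  filter_upwards [hs] with ω ⟨h1, h2⟩
  have h3 : F ω i i = ∑ k, F ω i k ^ 2 := by
    conv_lhs => rw [← h2, Matrix.mul_apply]
    refine Finset.sum_congr rfl fun k _ => ?_
    rw [show F ω k i = F ω i k from congrFun (congrFun h1 i) k, sq]
  have h4 : ∀ k, F ω i k ^ 2 ≤ F ω i i := fun k => by
    rw [h3]
    exact Finset.single_le_sum (f := fun k => F ω i k ^ 2) (fun _ _ => sq_nonneg _)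
      (Finset.mem_univ k)
  rw [Real.norm_eq_abs, ← sq_le_one_iff_abs_le_one]
  nlinarith [h4 i, h4 j]

/-- The mean of the orthogonal projection onto the row space of a Gaussian matrix. -/
theorem hasMean_pinv_mul_self {p d : ℕ} (hd : 0 < d) :
    HasMean (gaussianMatrix p d) (fun Z => fullRankPinv (Matrix.of Z) * Matrix.of Z)
      (biasFactor d p • 1) := by
  unfold biasFactor
  split_ifs with h
  · rw [one_smul]
    refine (HasMean.const 1).congr ?_
    filter_upwards [ae_isUnit_transpose_mul h] with Z hZ
    rw [fullRankPinv, if_pos h, Matrix.mul_assoc,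
      Matrix.nonsing_inv_mul _ ((Matrix.isUnit_iff_isUnit_det _).1 hZ)]
  · have hm : ∀ i j, Measurable fun Z : Fin p → Fin d → ℝ =>
        (fullRankPinv (Matrix.of Z) * Matrix.of Z) i j :=
      measurable_matrix_mul measurable_fullRankPinv fun i j => by
        simp only [Matrix.of_apply]; fun_prop
    refine hasMean_of_orthogonal_equivariant hd ?_ ?_ ?_
    · refine integrable_of_idempotent hm ?_
      filter_upwards [ae_pinv_eq_fullRankPinv p d] with Z hZ
      rw [← hZ]
      refine ⟨pinv_mul_symm _, ?_⟩
      rw [← Matrix.mul_assoc, pinv_mul_pinv]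
    · intro Q hQ Z
      rw [show Matrix.of (fun i j => (Matrix.of Z * Q) i j) = Matrix.of Z * Q from rfl,
        fullRankPinv_mul_orthogonal _ _ hQ]
      simp only [Matrix.mul_assoc]
    · have : ∀ᵐ Z ∂gaussianMatrix p d,
          (fullRankPinv (Matrix.of Z) * Matrix.of Z).trace = (p : ℝ) := by
        filter_upwards [ae_isUnit_mul_transpose (not_le.1 h).le] with Z hZ
        rw [fullRankPinv, if_neg h, Matrix.trace_mul_comm, ← Matrix.mul_assoc,
          Matrix.mul_nonsing_inv _ ((Matrix.isUnit_iff_isUnit_det _).1 hZ), Matrix.trace_one,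
          Fintype.card_fin]
      rw [integral_congr_ae this]
      simp

/-- The expectation of `‖Z⁺‖²` is the trace of an inverse Wishart matrix, of `Zᵀ Z` if `d ≤ p` and
of `Z Zᵀ` if `p < d`; it is infinite for `|p - d| ≤ 1`. -/
theorem lintegral_trace_pinv {p d : ℕ} (hd : 0 < d) (hp : 0 < p) :
    ∫⁻ Z, ENNReal.ofReal
        (fullRankPinv (Matrix.of Z) * (fullRankPinv (Matrix.of Z))ᵀ).trace ∂gaussianMatrix p d
      = if d + 2 ≤ p then ENNReal.ofReal (d / ((p : ℝ) - d - 1))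
        else if p + 2 ≤ d then ENNReal.ofReal (p / ((d : ℝ) - p - 1)) else ⊤ := by
  by_cases h : d ≤ p
  · have h1 : ¬ p + 2 ≤ d := by omega
    rw [if_neg h1, ← lintegral_trace_inv_gram hd h,
      ← (measurePreserving_transpose_gaussianMatrix p d).lintegral_comp]
    · refine lintegral_congr_ae ?_
      filter_upwards [ae_isUnit_transpose_mul h] with Z hZ
      congr 1
      have hdet := (Matrix.isUnit_iff_isUnit_det _).1 hZ
      rw [fullRankPinv, if_pos h, Matrix.transpose_mul, Matrix.transpose_transpose,
        Matrix.transpose_nonsing_inv, Matrix.transpose_mul, Matrix.transpose_transpose,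
        Matrix.mul_assoc, ← Matrix.mul_assoc _ (Matrix.of Z), Matrix.mul_nonsing_inv _ hdet,
        Matrix.mul_one]
      rfl
    · exact measurable_trace_inv_gram
  · have h1 : ¬ d + 2 ≤ p := by omega
    rw [if_neg h1, ← lintegral_trace_inv_gram hp (not_le.1 h).le]
    refine lintegral_congr_ae ?_
    filter_upwards [ae_isUnit_mul_transpose (not_le.1 h).le] with Z hZ
    congr 1
    have hdet := (Matrix.isUnit_iff_isUnit_det _).1 hZ
    rw [Matrix.trace_mul_comm, fullRankPinv, if_neg h, Matrix.transpose_mul,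
      Matrix.transpose_transpose, Matrix.transpose_nonsing_inv, Matrix.transpose_mul,
      Matrix.transpose_transpose, Matrix.mul_assoc, ← Matrix.mul_assoc _ (Matrix.of Z)ᵀ,
      Matrix.mul_nonsing_inv _ hdet, Matrix.mul_one]

/-- The factor of `σξ²` in the constant of a source task: `E Z⁺ Z⁺ᵀ` is this multiple of the
identity away from the interpolation threshold. -/
def noiseFactor (d p : ℕ) : ℝ :=
  if d + 2 ≤ p then 1 / ((p : ℝ) - d - 1) else (p : ℝ) / d * (1 / ((d : ℝ) - p - 1))

theorem hasMean_pinv_mul_transpose {p d : ℕ} (hd : 0 < d) (hp : 0 < p)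
    (h : d + 2 ≤ p ∨ p + 2 ≤ d) :
    HasMean (gaussianMatrix p d)
      (fun Z => fullRankPinv (Matrix.of Z) * (fullRankPinv (Matrix.of Z))ᵀ)
      (noiseFactor d p • 1) := by
  have hm : ∀ i j, Measurable fun Z : Fin p → Fin d → ℝ =>
      (fullRankPinv (Matrix.of Z) * (fullRankPinv (Matrix.of Z))ᵀ) i j :=
    measurable_matrix_mul measurable_fullRankPinv fun i j => measurable_fullRankPinv j i
  have hmt : Measurable fun Z : Fin p → Fin d → ℝ =>
      (fullRankPinv (Matrix.of Z) * (fullRankPinv (Matrix.of Z))ᵀ).trace :=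
    Finset.measurable_sum _ fun i _ => hm i i
  have hdiag : ∀ (B : Matrix (Fin d) (Fin p) ℝ) i, (B * Bᵀ) i i = ∑ k, B i k ^ 2 := by
    intro B i
    simp [Matrix.mul_apply, sq]
  have hdn : ∀ (B : Matrix (Fin d) (Fin p) ℝ) i, 0 ≤ (B * Bᵀ) i i := fun B i => by
    rw [hdiag]; positivity
  have htn : ∀ B : Matrix (Fin d) (Fin p) ℝ, 0 ≤ (B * Bᵀ).trace := fun B =>
    Finset.sum_nonneg fun i _ => hdn B i
  have hl := lintegral_trace_pinv hd hp
  have hti : Integrable (fun Z : Fin p → Fin d → ℝ =>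
      (fullRankPinv (Matrix.of Z) * (fullRankPinv (Matrix.of Z))ᵀ).trace) (gaussianMatrix p d) := by
    rw [← lintegral_ofReal_ne_top_iff_integrable hmt.aestronglyMeasurable
      (ae_of_all _ fun Z => htn _), hl]
    rcases h with h | h
    · rw [if_pos h]; exact ENNReal.ofReal_ne_top
    · rw [if_neg (by omega), if_pos h]; exact ENNReal.ofReal_ne_top
  have e : noiseFactor d p
      = (∫ Z, (fullRankPinv (Matrix.of Z) * (fullRankPinv (Matrix.of Z))ᵀ).trace
          ∂gaussianMatrix p d) / d := by
    have hd' : (d : ℝ) ≠ 0 := by positivity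
    rw [integral_eq_lintegral_of_nonneg_ae (ae_of_all _ fun Z => htn _) hmt.aestronglyMeasurable,
      hl, noiseFactor]
    rcases h with h | h
    · have : (d : ℝ) + 2 ≤ p := by exact_mod_cast h
      rw [if_pos h, if_pos h, ENNReal.toReal_ofReal (div_nonneg (by positivity) (by linarith))]
      field_simp
    · have : (p : ℝ) + 2 ≤ d := by exact_mod_cast h
      rw [if_neg (by omega), if_neg (by omega), if_pos h,
        ENNReal.toReal_ofReal (div_nonneg (by positivity) (by linarith))]
      ring
  rw [e]
  refine hasMean_of_orthogonal_equivariant hd (fun i j => ?_) ?_ rfl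
  · refine hti.mono (hm i j).aestronglyMeasurable (ae_of_all _ fun Z => ?_)
    set B := fullRankPinv (Matrix.of Z)
    rw [Real.norm_eq_abs, Real.norm_eq_abs, abs_of_nonneg (htn B)]
    have h1 : ∀ i, (B * Bᵀ) i i ≤ (B * Bᵀ).trace := fun i =>
      Finset.single_le_sum (f := fun i => (B * Bᵀ) i i) (fun i _ => hdn B i) (Finset.mem_univ i)
    have h2 : |(B * Bᵀ) i j| ≤ ((B * Bᵀ) i i + (B * Bᵀ) j j) / 2 := by
      rw [hdiag, hdiag, ← Finset.sum_add_distrib, Finset.sum_div, Matrix.mul_apply]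
      refine (Finset.abs_sum_le_sum_abs _ _).trans (Finset.sum_le_sum fun k _ => ?_)
      rw [Matrix.transpose_apply, abs_le]
      constructor <;> nlinarith [sq_nonneg (B i k + B j k), sq_nonneg (B i k - B j k)]
    linarith [h1 i, h1 j]
  · intro Q hQ Z
    rw [show Matrix.of (fun i j => (Matrix.of Z * Q) i j) = Matrix.of Z * Q from rfl,
      fullRankPinv_mul_orthogonal _ _ hQ]
    simp only [Matrix.transpose_mul, Matrix.transpose_transpose, Matrix.mul_assoc]

/-! ### Second moments of linear forms in uncorrelated variables -/

/-- The random variables `x i` are square integrable, centered and pairwise uncorrelated, with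
variances `t i`. -/
structure Uncorrelated {Ω ι : Type*} [MeasurableSpace Ω] [DecidableEq ι] (μ : Measure Ω)
    (x : ι → Ω → ℝ) (t : ι → ℝ) : Prop where
  memLp : ∀ i, MemLp (x i) 2 μ
  mean : ∀ i, ∫ ω, x i ω ∂μ = 0
  cov : ∀ i j, ∫ ω, x i ω * x j ω ∂μ = if i = j then t i else 0

namespace Uncorrelated

variable {Ω ι : Type*} [MeasurableSpace Ω] [DecidableEq ι] {μ : Measure Ω} {x : ι → Ω → ℝ}
  {t : ι → ℝ}

theorem memLp_add_sum [Fintype ι] [IsProbabilityMeasure μ] (h : Uncorrelated μ x t) (a : ℝ)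
    (c : ι → ℝ) : MemLp (fun ω => a + ∑ i, c i * x i ω) 2 μ :=
  (memLp_const a).add (memLp_finsetSum _ fun i _ => (h.memLp i).const_mul (c i))

theorem integral_sq_add_sum [Fintype ι] [IsProbabilityMeasure μ] (h : Uncorrelated μ x t) (a : ℝ)
    (c : ι → ℝ) : ∫ ω, (a + ∑ i, c i * x i ω) ^ 2 ∂μ = a ^ 2 + ∑ i, t i * c i ^ 2 := by
  have hint : ∀ i, Integrable (x i) μ := fun i => (h.memLp i).integrable (by norm_num)
  have hint2 : ∀ i j, Integrable (fun ω => x i ω * x j ω) μ := fun i j =>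
    (h.memLp i).integrable_mul (h.memLp j)
  have e : ∀ ω, (a + ∑ i, c i * x i ω) ^ 2
      = a ^ 2 + ((∑ i, 2 * a * c i * x i ω) + ∑ i, ∑ j, c i * c j * (x i ω * x j ω)) := by
    intro ω
    have : ∑ i, ∑ j, c i * c j * (x i ω * x j ω) = (∑ i, c i * x i ω) ^ 2 := by
      rw [sq, Finset.sum_mul_sum]
      exact Finset.sum_congr rfl fun i _ => Finset.sum_congr rfl fun j _ => by ring
    rw [this]
    have : ∑ i, 2 * a * c i * x i ω = 2 * a * ∑ i, c i * x i ω := by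
      rw [Finset.mul_sum]
      exact Finset.sum_congr rfl fun i _ => by ring
    rw [this]
    ring
  simp_rw [e]
  have i1 : Integrable (fun ω => ∑ i, 2 * a * c i * x i ω) μ :=
    integrable_finsetSum _ fun i _ => (hint i).const_mul _
  have i2 : Integrable (fun ω => ∑ i, ∑ j, c i * c j * (x i ω * x j ω)) μ :=
    integrable_finsetSum _ fun i _ => integrable_finsetSum _ fun j _ => (hint2 i j).const_mul _
  rw [integral_add (integrable_const _) (by exact i1.add i2), integral_add i1 i2,
    integral_finsetSum _ fun i _ => (hint i).const_mul _, integral_finsetSum _ fun i _ =>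
      integrable_finsetSum _ fun j _ => (hint2 i j).const_mul _]
  simp only [integral_const, probReal_univ, one_smul, integral_const_mul, h.mean, mul_zero,
    Finset.sum_const_zero, zero_add]
  congr 1
  refine Finset.sum_congr rfl fun i _ => ?_
  rw [integral_finsetSum _ fun j _ => (hint2 i j).const_mul _]
  simp only [integral_const_mul, h.cov, mul_ite, mul_zero, Finset.sum_ite_eq, Finset.mem_univ,
    if_true]
  ring

theorem lintegral_add_sum_sq [Fintype ι] [IsProbabilityMeasure μ] (h : Uncorrelated μ x t)
    {r : ℕ} {c : ℝ} (hc : 0 ≤ c) (a : Fin r → ℝ) (B : Fin r → ι → ℝ) :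
    ∫⁻ ω, ENNReal.ofReal (c + ∑ k, (a k + ∑ i, B k i * x i ω) ^ 2) ∂μ
      = ENNReal.ofReal (c + ∑ k, a k ^ 2 + ∑ i, t i * ∑ k, B k i ^ 2) := by
  have i1 : ∀ k, Integrable (fun ω => (a k + ∑ i, B k i * x i ω) ^ 2) μ := fun k =>
    (h.memLp_add_sum (a k) (B k)).integrable_sq
  have i2 : Integrable (fun ω => c + ∑ k, (a k + ∑ i, B k i * x i ω) ^ 2) μ :=
    (integrable_const c).add (integrable_finsetSum _ fun k _ => i1 k)
  rw [← ofReal_integral_eq_lintegral_ofReal i2 (ae_of_all _ fun ω => by positivity)]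
  congr 1
  rw [integral_add (integrable_const c) (integrable_finsetSum _ fun k _ => i1 k),
    integral_finsetSum _ fun k _ => i1 k]
  simp only [h.integral_sq_add_sum, Finset.sum_add_distrib, integral_const, probReal_univ, one_smul]
  rw [Finset.sum_comm]
  simp only [Finset.mul_sum, add_assoc]

theorem pi {m : ℕ} {Ω : Fin m → Type*} [∀ j, MeasurableSpace (Ω j)]
    {μ : (j : Fin m) → Measure (Ω j)} [∀ j, IsProbabilityMeasure (μ j)] {κ : Fin m → Type*}
    [∀ j, DecidableEq (κ j)] {x : (j : Fin m) → κ j → Ω j → ℝ} {t : (j : Fin m) → κ j → ℝ}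
    (h : ∀ j, Uncorrelated (μ j) (x j) (t j)) :
    Uncorrelated (Measure.pi μ) (fun (i : (j : Fin m) × κ j) ω => x i.1 i.2 (ω i.1))
      (fun i => t i.1 i.2) where
  memLp i := ((h i.1).memLp i.2).comp_measurePreserving (measurePreserving_eval μ i.1)
  mean i := by
    rw [integral_comp_eval ((h i.1).memLp i.2).aestronglyMeasurable, (h i.1).mean]
  cov := by
    rintro ⟨j, k⟩ ⟨j', k'⟩
    by_cases hj : j = j'
    · subst hj
      have := integral_comp_eval (μ := μ) (i := j) (f := fun u => x j k u * x j k' u)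
        (((h j).memLp k).integrable_mul ((h j).memLp k')).aestronglyMeasurable
      simp only [this, (h j).cov, Sigma.mk.injEq, true_and, heq_eq_eq]
    · have hne : ¬ ((⟨j, k⟩ : (j : Fin m) × κ j) = ⟨j', k'⟩) := fun e => hj (congrArg Sigma.fst e)
      rw [if_neg hne]
      have hind : IndepFun (fun ω : (j : Fin m) → Ω j => x j k (ω j))
          (fun ω => x j' k' (ω j')) (Measure.pi μ) := by
        have h0 := (iIndepFun_pi (μ := μ) (X := fun j ω => ω) fun j => aemeasurable_id).indepFun hj
        exact h0.comp₀ (measurable_pi_apply j).aemeasurable (measurable_pi_apply j').aemeasurable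
          (by rw [(measurePreserving_eval μ j).map_eq]; exact ((h j).memLp k).aemeasurable)
          (by rw [(measurePreserving_eval μ j').map_eq]; exact ((h j').memLp k').aemeasurable)
      rw [hind.integral_fun_mul_eq_mul_integral
        (((h j).memLp k).comp_measurePreserving (measurePreserving_eval μ j)).aestronglyMeasurable
        (((h j').memLp k').comp_measurePreserving (measurePreserving_eval μ j')).aestronglyMeasurable,
        integral_comp_eval ((h j).memLp k).aestronglyMeasurable, (h j).mean, zero_mul]

theorem comp_injective {κ : Type*} [DecidableEq κ] (h : Uncorrelated μ x t) (f : κ → ι)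
    (hf : Function.Injective f) :
    Uncorrelated μ (fun k => x (f k)) (fun k => t (f k)) where
  memLp k := h.memLp _
  mean k := h.mean _
  cov k l := by rw [h.cov]; simp [hf.eq_iff]

end Uncorrelated

theorem IsNoise.uncorrelated {ν : Measure ℝ} {t : ℝ} (h : IsNoise ν t) :
    Uncorrelated ν (fun (_ : Unit) u => u) (fun _ => t) where
  memLp _ := h.memLp
  mean _ := h.mean
  cov _ _ := by simp only [if_true, ← h.var, sq]

theorem IsNoise.uncorrelated_pi {ν : Measure ℝ} {t : ℝ} (h : IsNoise ν t) (N : ℕ) :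
    Uncorrelated (Measure.pi fun _ : Fin N => ν) (fun i ω => ω i) (fun _ => t) := by
  have := h.prob
  exact (Uncorrelated.pi fun _ : Fin N => h.uncorrelated).comp_injective (fun i => ⟨i, ()⟩)
    fun i j hij => congrArg Sigma.fst hij

theorem IsIsotropic.uncorrelated {d : ℕ} {ν : Measure (Fin d → ℝ)} (h : IsIsotropic ν) :
    Uncorrelated ν (fun i ω => ω i) (fun _ => 1) where
  memLp := h.memLp
  mean := h.mean
  cov i j := by rw [h.cov, Matrix.one_apply]

theorem isNoise_gaussianReal {t : ℝ} (ht : 0 ≤ t) : IsNoise (gaussianReal 0 t.toNNReal) t where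
  prob := inferInstance
  memLp := memLp_id_gaussianReal 2
  mean := by simp
  var := by
    have := variance_fun_id_gaussianReal (μ := 0) (v := t.toNNReal)
    rw [variance_eq_integral (by fun_prop)] at this
    simpa [ht] using this

theorem uncorrelated_isoGaussian (d : ℕ) {t : ℝ} (ht : 0 ≤ t) :
    Uncorrelated (isoGaussian d t) (fun i ω => ω i) (fun _ => t) :=
  (isNoise_gaussianReal ht).uncorrelated_pi d

/-- The squared Frobenius norm of a matrix. -/
def sqFrob {p q : ℕ} (A : Matrix (Fin p) (Fin q) ℝ) : ℝ := ∑ j, ∑ i, A i j ^ 2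

theorem sqFrob_nonneg {p q : ℕ} (A : Matrix (Fin p) (Fin q) ℝ) : 0 ≤ sqFrob A := by
  unfold sqFrob; positivity

/-- The mean squared prediction error when, for given designs, the error of the estimator is a
linear function of the target parameter, of the task noises and of the source and target noises. -/
theorem lintegral_sq_linear_error {m d n : ℕ} {nt : Fin m → ℕ} {b σε : ℝ} {ση σξ : Fin m → ℝ}
    (hb : 0 ≤ b) {νx : Measure (Fin d → ℝ)} (hνx : IsIsotropic νx)
    {νε : Measure ℝ} (hνε : IsNoise νε (σε ^ 2)) {νξ : Fin m → Measure ℝ}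
    (hνξ : ∀ j, IsNoise (νξ j) (σξ j ^ 2))
    (T1 : Matrix (Fin d) (Fin n) ℝ) (T2 : Matrix (Fin d) (Fin d) ℝ)
    (T3 : Fin m → Matrix (Fin d) (Fin d) ℝ) (T4 : (j : Fin m) → Matrix (Fin d) (Fin (nt j)) ℝ) :
    ∫⁻ β, ∫⁻ η, ∫⁻ ξ, ∫⁻ ε, ∫⁻ x, ∫⁻ e, ENNReal.ofReal
      ((x ⬝ᵥ (T2 *ᵥ β + ∑ j, T3 j *ᵥ η j + ∑ j, T4 j *ᵥ ξ j + T1 *ᵥ ε) - e) ^ 2)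
      ∂νε ∂νx ∂(Measure.pi fun _ : Fin n => νε)
      ∂(Measure.pi fun j => Measure.pi fun _ : Fin (nt j) => νξ j)
      ∂(Measure.pi fun j => isoGaussian d (ση j ^ 2 / d)) ∂isoGaussian d (b / d)
    = ENNReal.ofReal (σε ^ 2 + σε ^ 2 * sqFrob T1 + ∑ j, σξ j ^ 2 * sqFrob (T4 j)
        + ∑ j, ση j ^ 2 / d * sqFrob (T3 j) + b / d * sqFrob T2) := by
  have := hνx.prob
  have := hνε.prob
  have := fun j => (hνξ j).prob
  have hx : ∀ u : Fin d → ℝ, ∫⁻ x, ∫⁻ e, ENNReal.ofReal ((x ⬝ᵥ u - e) ^ 2) ∂νε ∂νx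
      = ENNReal.ofReal (σε ^ 2 + ∑ k, u k ^ 2) := by
    intro u
    have h1 : ∀ x : Fin d → ℝ, ∫⁻ e, ENNReal.ofReal ((x ⬝ᵥ u - e) ^ 2) ∂νε
        = ENNReal.ofReal (σε ^ 2 + ∑ _k : Fin 1, (0 + ∑ i, u i * x i) ^ 2) := by
      intro x
      have := hνε.uncorrelated.lintegral_add_sum_sq le_rfl (r := 1) (fun _ => x ⬝ᵥ u)
        (fun _ _ => -1)
      simp only [Finset.univ_unique, Finset.sum_singleton, zero_add, neg_one_mul,
        ← sub_eq_add_neg] at this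
      rw [this]
      congr 1
      simp [dotProduct, mul_comm, add_comm]
    simp_rw [h1]
    rw [hνx.uncorrelated.lintegral_add_sum_sq (sq_nonneg _) (r := 1) (fun _ => 0)
      (fun _ i => u i)]
    simp
  have hε : ∀ a : Fin d → ℝ, ∫⁻ ε, ENNReal.ofReal (σε ^ 2 + ∑ k, (a + T1 *ᵥ ε) k ^ 2)
      ∂(Measure.pi fun _ : Fin n => νε)
      = ENNReal.ofReal (σε ^ 2 + σε ^ 2 * sqFrob T1 + ∑ k, a k ^ 2) := by
    intro a
    have := (hνε.uncorrelated_pi n).lintegral_add_sum_sq (sq_nonneg σε) a T1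
    simp only [Pi.add_apply, Matrix.mulVec, dotProduct, this]
    rw [sqFrob, Finset.mul_sum]
    congr 1; ring
  set c1 := σε ^ 2 + σε ^ 2 * sqFrob T1 with hc1
  have hc1n : 0 ≤ c1 := add_nonneg (sq_nonneg _) (mul_nonneg (sq_nonneg _) (sqFrob_nonneg _))
  have hξ : ∀ a : Fin d → ℝ, ∫⁻ ξ, ENNReal.ofReal (c1 + ∑ k, (a + ∑ j, T4 j *ᵥ ξ j) k ^ 2)
      ∂(Measure.pi fun j => Measure.pi fun _ : Fin (nt j) => νξ j)
      = ENNReal.ofReal (c1 + ∑ j, σξ j ^ 2 * sqFrob (T4 j) + ∑ k, a k ^ 2) := by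
    intro a
    have := (Uncorrelated.pi fun j => (hνξ j).uncorrelated_pi (nt j)).lintegral_add_sum_sq hc1n a
      (fun k i => T4 i.1 k i.2)
    simp only [Fintype.sum_sigma] at this
    simp only [Pi.add_apply, Finset.sum_apply, Matrix.mulVec, dotProduct, this]
    simp only [sqFrob, Finset.mul_sum]
    congr 1; ring
  set c2 := c1 + ∑ j, σξ j ^ 2 * sqFrob (T4 j) with hc2
  have hc2n : 0 ≤ c2 := add_nonneg hc1n (Finset.sum_nonneg fun j _ =>
    mul_nonneg (sq_nonneg _) (sqFrob_nonneg _))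
  have hη : ∀ a : Fin d → ℝ, ∫⁻ η, ENNReal.ofReal (c2 + ∑ k, (a + ∑ j, T3 j *ᵥ η j) k ^ 2)
      ∂(Measure.pi fun j => isoGaussian d (ση j ^ 2 / d))
      = ENNReal.ofReal (c2 + ∑ j, ση j ^ 2 / d * sqFrob (T3 j) + ∑ k, a k ^ 2) := by
    intro a
    have := (Uncorrelated.pi fun j => uncorrelated_isoGaussian d
      (t := ση j ^ 2 / d) (by positivity)).lintegral_add_sum_sq hc2n a (fun k i => T3 i.1 k i.2)
    simp only [Fintype.sum_sigma] at this
    simp only [Pi.add_apply, Finset.sum_apply, Matrix.mulVec, dotProduct, this]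
    simp only [sqFrob, Finset.mul_sum]
    congr 1; ring
  set c3 := c2 + ∑ j, ση j ^ 2 / d * sqFrob (T3 j) with hc3
  have hc3n : 0 ≤ c3 := add_nonneg hc2n (Finset.sum_nonneg fun j _ =>
    mul_nonneg (by positivity) (sqFrob_nonneg _))
  simp only [hx, hε, hξ, hη]
  have := (uncorrelated_isoGaussian d (t := b / d) (by positivity)).lintegral_add_sum_sq hc3n
    (fun _ => 0) T2
  simp only [zero_add] at this
  simp only [Matrix.mulVec, dotProduct, this]
  simp [sqFrob, Finset.mul_sum]

/-- Tonelli's theorem for a product of eight measures, with the fifth and the third variable moved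
to the outermost positions. -/
theorem lintegral_prod_reorder {α₁ α₂ α₃ α₄ α₅ α₆ α₇ α₈ : Type*} [MeasurableSpace α₁]
    [MeasurableSpace α₂] [MeasurableSpace α₃] [MeasurableSpace α₄] [MeasurableSpace α₅]
    [MeasurableSpace α₆] [MeasurableSpace α₇] [MeasurableSpace α₈]
    (μ₁ : Measure α₁) (μ₂ : Measure α₂) (μ₃ : Measure α₃) (μ₄ : Measure α₄) (μ₅ : Measure α₅)
    (μ₆ : Measure α₆) (μ₇ : Measure α₇) (μ₈ : Measure α₈) [SFinite μ₁] [SFinite μ₂] [SFinite μ₃]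
    [SFinite μ₄] [SFinite μ₅] [SFinite μ₆] [SFinite μ₇] [SFinite μ₈]
    {f : α₁ × α₂ × α₃ × α₄ × α₅ × α₆ × α₇ × α₈ → ℝ≥0∞} (hf : Measurable f) :
    ∫⁻ p, f p ∂(μ₁.prod <| μ₂.prod <| μ₃.prod <| μ₄.prod <| μ₅.prod <| μ₆.prod <| μ₇.prod μ₈)
      = ∫⁻ x₅, ∫⁻ x₃, ∫⁻ x₁, ∫⁻ x₂, ∫⁻ x₄, ∫⁻ x₆, ∫⁻ x₇, ∫⁻ x₈,
        f (x₁, x₂, x₃, x₄, x₅, x₆, x₇, x₈) ∂μ₈ ∂μ₇ ∂μ₆ ∂μ₄ ∂μ₂ ∂μ₁ ∂μ₃ ∂μ₅ := by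
  set ρ := μ₆.prod (μ₇.prod μ₈) with hρ
  have hRf : ∀ x₁ x₂ x₃ x₄ x₅, ∫⁻ x₆, ∫⁻ x₇, ∫⁻ x₈,
        f (x₁, x₂, x₃, x₄, x₅, x₆, x₇, x₈) ∂μ₈ ∂μ₇ ∂μ₆
      = ∫⁻ r, f (x₁, x₂, x₃, x₄, x₅, r) ∂ρ := by
    intro x₁ x₂ x₃ x₄ x₅
    rw [hρ, lintegral_prod _ (by fun_prop)]
    refine lintegral_congr fun x₆ => ?_
    rw [lintegral_prod _ (by fun_prop)]
  simp_rw [hRf]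
  have h4 : Measurable fun p : (α₁ × α₂) × (α₃ × α₅) =>
      ∫⁻ x₄, ∫⁻ r, f (p.1.1, p.1.2, p.2.1, x₄, p.2.2, r) ∂ρ ∂μ₄ := by
    have h0 : Measurable fun q : (((α₁ × α₂) × (α₃ × α₅)) × α₄) × (α₆ × α₇ × α₈) =>
        f (q.1.1.1.1, q.1.1.1.2, q.1.1.2.1, q.1.2, q.1.1.2.2, q.2) := by fun_prop
    exact (h0.lintegral_prod_right' (ν := ρ)).lintegral_prod_right' (ν := μ₄)
  calc _ = ∫⁻ x₁, ∫⁻ x₂, ∫⁻ x₃, ∫⁻ x₄, ∫⁻ x₅, ∫⁻ r, f (x₁, x₂, x₃, x₄, x₅, r) ∂ρ ∂μ₅ ∂μ₄ ∂μ₃ ∂μ₂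
          ∂μ₁ := by
        rw [lintegral_prod _ (by fun_prop)]
        refine lintegral_congr fun x₁ => ?_
        rw [lintegral_prod _ (by fun_prop)]
        refine lintegral_congr fun x₂ => ?_
        rw [lintegral_prod _ (by fun_prop)]
        refine lintegral_congr fun x₃ => ?_
        rw [lintegral_prod _ (by fun_prop)]
        refine lintegral_congr fun x₄ => ?_
        rw [lintegral_prod _ (by fun_prop)]
    _ = ∫⁻ x₁, ∫⁻ x₂, ∫⁻ z, ∫⁻ x₄, ∫⁻ r, f (x₁, x₂, z.1, x₄, z.2, r) ∂ρ ∂μ₄ ∂(μ₃.prod μ₅) ∂μ₂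
          ∂μ₁ := by
        refine lintegral_congr fun x₁ => lintegral_congr fun x₂ => ?_
        rw [lintegral_prod _ (by exact (h4.comp (measurable_prodMk_left (x := (x₁, x₂)))).aemeasurable)]
        refine lintegral_congr fun x₃ => lintegral_lintegral_swap ?_
        have h0 : Measurable fun q : (α₄ × α₅) × (α₆ × α₇ × α₈) =>
            f (x₁, x₂, x₃, q.1.1, q.1.2, q.2) := by fun_prop
        exact (h0.lintegral_prod_right' (ν := ρ)).aemeasurable
    _ = ∫⁻ w, ∫⁻ z, ∫⁻ x₄, ∫⁻ r, f (w.1, w.2, z.1, x₄, z.2, r) ∂ρ ∂μ₄ ∂(μ₃.prod μ₅)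
          ∂(μ₁.prod μ₂) := by
        rw [lintegral_prod _ (h4.lintegral_prod_right' (ν := μ₃.prod μ₅)).aemeasurable]
    _ = ∫⁻ z, ∫⁻ w, ∫⁻ x₄, ∫⁻ r, f (w.1, w.2, z.1, x₄, z.2, r) ∂ρ ∂μ₄ ∂(μ₁.prod μ₂)
          ∂(μ₃.prod μ₅) := lintegral_lintegral_swap h4.aemeasurable
    _ = _ := by
        rw [lintegral_prod_symm _ (by exact (h4.comp measurable_swap |>.lintegral_prod_right'
          (ν := μ₁.prod μ₂)).aemeasurable)]
        refine lintegral_congr fun x₅ => lintegral_congr fun x₃ => ?_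
        rw [lintegral_prod _ (by exact (h4.comp measurable_prodMk_right).aemeasurable)]

/-! ### The test error conditional on the designs -/

/-- The regularized Gram matrix of the target design, for `m` orthonormal source tasks. -/
def ridge (m : ℕ) {d n : ℕ} (X : Matrix (Fin n) (Fin d) ℝ) (α : ℝ) : Matrix (Fin d) (Fin d) ℝ :=
  Xᵀ * X + (m * n * α) • (1 : Matrix (Fin d) (Fin d) ℝ)

section LinearForm

variable {m d n : ℕ} {nt : Fin m → ℕ} (H : Fin m → Matrix (Fin d) (Fin d) ℝ) (α : ℝ)
  (X : Matrix (Fin n) (Fin d) ℝ) (Z : (j : Fin m) → Matrix (Fin (nt j)) (Fin d) ℝ)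

/-- The coefficient of the target parameter in the estimation error, for full-rank source designs:
the bias due to overparameterized source tasks. -/
def biasCoeff : Matrix (Fin d) (Fin d) ℝ :=
  (n * α) • ((ridge m X α)⁻¹ *
    ∑ j, ((H j)ᵀ * (fullRankPinv (Z j) * Z j) * H j - 1))

/-- The coefficient of the noise of task relation `j` in the estimation error, for full-rank source
designs. -/
def taskCoeff (j : Fin m) : Matrix (Fin d) (Fin d) ℝ :=
  (n * α) • ((ridge m X α)⁻¹ * ((H j)ᵀ * (fullRankPinv (Z j) * Z j)))

/-- The coefficient of the noise in the data of source task `j` in the estimation error, for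
full-rank source designs. -/
def sourceCoeff (j : Fin m) : Matrix (Fin d) (Fin (nt j)) ℝ :=
  (n * α) • ((ridge m X α)⁻¹ * ((H j)ᵀ * fullRankPinv (Z j)))

/-- The mean squared prediction error given full-rank designs. -/
def condError (b σε : ℝ) (ση σξ : Fin m → ℝ) : ℝ :=
  σε ^ 2 + σε ^ 2 * sqFrob ((ridge m X α)⁻¹ * Xᵀ)
    + ∑ j, σξ j ^ 2 * sqFrob (sourceCoeff H α X Z j)
    + ∑ j, ση j ^ 2 / d * sqFrob (taskCoeff H α X Z j)
    + b / d * sqFrob (biasCoeff H α X Z)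

end LinearForm

/-- The estimation error as a linear form. The target parameter is written as `G (ridge β)` with
`G` the inverse of `ridge`, so that its part in `β` cancels up to the bias of the source tasks. -/
theorem βhat_eq {m d n : ℕ} {nt : Fin m → ℕ} (s : Sample m d n nt)
    (H : Fin m → Matrix (Fin d) (Fin d) ℝ) (horth : ∀ j, (H j)ᵀ * H j = 1) (α : ℝ)
    (hK : IsUnit (ridge m s.X α)) (hZ : ∀ j, pinv (s.Z j) = fullRankPinv (s.Z j)) :
    s.βhat H H α = s.β + (biasCoeff H α s.X s.Z *ᵥ s.β + ∑ j, taskCoeff H α s.X s.Z j *ᵥ s.η j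
      + ∑ j, sourceCoeff H α s.X s.Z j *ᵥ s.ξ j + ((ridge m s.X α)⁻¹ * s.Xᵀ) *ᵥ s.ε) := by
  have hridge : s.Xᵀ * s.X + (n * α) • ∑ j, (H j)ᵀ * H j = ridge m s.X α := by
    simp only [horth, ridge, Finset.sum_const, Finset.card_univ, Fintype.card_fin]
    rw [← Nat.cast_smul_eq_nsmul ℝ, smul_smul]
    congr 2; ring
  have hdet := (Matrix.isUnit_iff_isUnit_det _).1 hK
  unfold Sample.βhat estimator
  rw [hridge]
  set G := (ridge m s.X α)⁻¹ with hG
  have hβ : s.β = G *ᵥ (ridge m s.X α *ᵥ s.β) := by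
    rw [Matrix.mulVec_mulVec, hG, Matrix.nonsing_inv_mul _ hdet, Matrix.one_mulVec]
  have h2 : biasCoeff H α s.X s.Z *ᵥ s.β = G *ᵥ ((n * α) •
      ∑ j, ((H j)ᵀ *ᵥ (fullRankPinv (s.Z j) *ᵥ (s.Z j *ᵥ (H j *ᵥ s.β))) - s.β)) := by
    simp only [biasCoeff, ← hG, Matrix.smul_mulVec, Matrix.mulVec_smul, ← Matrix.mulVec_mulVec,
      Matrix.sum_mulVec, Matrix.sub_mulVec, Matrix.one_mulVec]
  have h3 : ∀ j, taskCoeff H α s.X s.Z j *ᵥ s.η j = G *ᵥ ((n * α) •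
      ((H j)ᵀ *ᵥ (fullRankPinv (s.Z j) *ᵥ (s.Z j *ᵥ s.η j)))) := by
    intro j
    simp only [taskCoeff, ← hG, Matrix.smul_mulVec, Matrix.mulVec_smul, ← Matrix.mulVec_mulVec]
  have h4 : ∀ j, sourceCoeff H α s.X s.Z j *ᵥ s.ξ j = G *ᵥ ((n * α) •
      ((H j)ᵀ *ᵥ (fullRankPinv (s.Z j) *ᵥ s.ξ j))) := by
    intro j
    simp only [sourceCoeff, ← hG, Matrix.smul_mulVec, Matrix.mulVec_smul, ← Matrix.mulVec_mulVec]
  have hsum : ∀ f : Fin m → Fin d → ℝ, ∑ j, G *ᵥ f j = G *ᵥ ∑ j, f j := fun f =>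
    (map_sum (Matrix.mulVecLin G) f Finset.univ).symm
  simp only [h2, h3, h4, hsum, ← Matrix.mulVec_mulVec]
  nth_rewrite 1 [hβ]
  simp only [← Matrix.mulVec_add]
  congr 1
  simp only [ridge, Sample.y, Sample.θhat, Sample.v, Sample.θ, hZ, Matrix.mulVec_add,
    Matrix.add_mulVec, Matrix.smul_mulVec, Matrix.one_mulVec, Finset.sum_add_distrib,
    Finset.sum_sub_distrib, ← Finset.smul_sum, Finset.sum_const, Finset.card_univ,
    Fintype.card_fin, ← Matrix.mulVec_mulVec, ← Nat.cast_smul_eq_nsmul ℝ]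
  module

theorem sq_prediction_error_eq {m d n : ℕ} {nt : Fin m → ℕ} (s : Sample m d n nt)
    (H : Fin m → Matrix (Fin d) (Fin d) ℝ) (horth : ∀ j, (H j)ᵀ * H j = 1) (α : ℝ)
    (hK : IsUnit (ridge m s.X α)) (hZ : ∀ j, pinv (s.Z j) = fullRankPinv (s.Z j)) :
    s.xtest ⬝ᵥ s.βhat H H α - s.ytest
      = s.xtest ⬝ᵥ (biasCoeff H α s.X s.Z *ᵥ s.β + ∑ j, taskCoeff H α s.X s.Z j *ᵥ s.η j
      + ∑ j, sourceCoeff H α s.X s.Z j *ᵥ s.ξ j + ((ridge m s.X α)⁻¹ * s.Xᵀ) *ᵥ s.ε) - s.εtest := by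
  rw [βhat_eq s H horth α hK hZ, dotProduct_add, Sample.ytest]
  ring

/-! ### Measurability in the designs -/

section Measurability

variable {Ω : Type*} [MeasurableSpace Ω] {m d n : ℕ} {nt : Fin m → ℕ}
  {X : Ω → Matrix (Fin n) (Fin d) ℝ} {Z : Ω → (j : Fin m) → Matrix (Fin (nt j)) (Fin d) ℝ}

theorem measurable_mulVec {p q : ℕ} {A : Ω → Matrix (Fin p) (Fin q) ℝ} {v : Ω → Fin q → ℝ}
    (hA : ∀ i j, Measurable fun ω => A ω i j) (hv : Measurable v) :
    Measurable fun ω => A ω *ᵥ v ω := by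
  refine measurable_pi_lambda _ fun i => ?_
  simp only [Matrix.mulVec, dotProduct]
  exact Finset.measurable_sum _ fun j _ => (hA i j).mul ((measurable_pi_apply j).comp hv)

theorem measurable_inv_ridge (hX : ∀ i j, Measurable fun ω => X ω i j) (α : ℝ) (i j : Fin d) :
    Measurable fun ω => (ridge m (X ω) α)⁻¹ i j := by
  refine measurable_matrix_inv (fun i j => ?_) i j
  simp only [ridge, Matrix.add_apply]
  exact (measurable_matrix_mul (A := fun ω => (X ω)ᵀ) (fun i j => hX j i) hX i j).add
    measurable_const

theorem measurable_inv_ridge_mul (hX : ∀ i j, Measurable fun ω => X ω i j) (α : ℝ) (i : Fin d)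
    (j : Fin n) : Measurable fun ω => ((ridge m (X ω) α)⁻¹ * (X ω)ᵀ) i j :=
  measurable_matrix_mul (measurable_inv_ridge hX α) (fun i j => hX j i) i j

theorem measurable_fullRankPinv_comp (hZ : Measurable fun ω j i k => Z ω j i k) (j : Fin m)
    (i : Fin d) (k : Fin (nt j)) : Measurable fun ω => fullRankPinv (Z ω j) i k :=
  (measurable_fullRankPinv i k).comp ((measurable_pi_apply j).comp hZ)

theorem measurable_fullRankPinv_mul_self (hZ : Measurable fun ω j i k => Z ω j i k) (j : Fin m)
    (i k : Fin d) : Measurable fun ω => (fullRankPinv (Z ω j) * Z ω j) i k :=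
  measurable_matrix_mul (measurable_fullRankPinv_comp hZ j) (fun i k =>
    (measurable_pi_apply k).comp ((measurable_pi_apply i).comp ((measurable_pi_apply j).comp hZ)))
    i k

variable (H : Fin m → Matrix (Fin d) (Fin d) ℝ) (α : ℝ)

theorem measurable_biasCoeff (hX : ∀ i j, Measurable fun ω => X ω i j)
    (hZ : Measurable fun ω j i k => Z ω j i k) (i k : Fin d) :
    Measurable fun ω => biasCoeff H α (X ω) (Z ω) i k := by
  have h1 : ∀ j i k, Measurable fun ω => ((H j)ᵀ * (fullRankPinv (Z ω j) * Z ω j)) i k := fun j =>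
    measurable_matrix_mul (A := fun _ => (H j)ᵀ) (fun _ _ => measurable_const)
      (measurable_fullRankPinv_mul_self hZ j)
  have h2 : ∀ j i k, Measurable fun ω => ((H j)ᵀ * (fullRankPinv (Z ω j) * Z ω j) * H j) i k :=
    fun j => measurable_matrix_mul (B := fun _ => H j) (h1 j) (fun _ _ => measurable_const)
  have h3 : ∀ i k, Measurable fun ω =>
      (∑ j, ((H j)ᵀ * (fullRankPinv (Z ω j) * Z ω j) * H j - 1) : Matrix (Fin d) (Fin d) ℝ) i k := by
    intro i k
    simp only [Matrix.sum_apply, Matrix.sub_apply]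
    exact Finset.measurable_sum _ fun j _ => (h2 j i k).sub_const _
  exact (measurable_matrix_mul (measurable_inv_ridge hX α) h3 i k).const_mul _

theorem measurable_taskCoeff (hX : ∀ i j, Measurable fun ω => X ω i j)
    (hZ : Measurable fun ω j i k => Z ω j i k) (j : Fin m) (i k : Fin d) :
    Measurable fun ω => taskCoeff H α (X ω) (Z ω) j i k := by
  have h1 : ∀ i k, Measurable fun ω => ((H j)ᵀ * (fullRankPinv (Z ω j) * Z ω j)) i k :=
    measurable_matrix_mul (A := fun _ => (H j)ᵀ) (fun _ _ => measurable_const)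
      (measurable_fullRankPinv_mul_self hZ j)
  exact (measurable_matrix_mul (measurable_inv_ridge hX α) h1 i k).const_mul _

theorem measurable_sourceCoeff (hX : ∀ i j, Measurable fun ω => X ω i j)
    (hZ : Measurable fun ω j i k => Z ω j i k) (j : Fin m) (i : Fin d) (k : Fin (nt j)) :
    Measurable fun ω => sourceCoeff H α (X ω) (Z ω) j i k := by
  have h1 : ∀ i k, Measurable fun ω => ((H j)ᵀ * fullRankPinv (Z ω j)) i k :=
    measurable_matrix_mul (A := fun _ => (H j)ᵀ) (fun _ _ => measurable_const)
      (measurable_fullRankPinv_comp hZ j)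
  exact (measurable_matrix_mul (measurable_inv_ridge hX α) h1 i k).const_mul _

end Measurability

/-! ### The test error as an integral over the designs -/

/-- The space of realizations of all the random quantities. -/
abbrev DataTuple (m d n : ℕ) (nt : Fin m → ℕ) : Type :=
  (Fin d → ℝ) × (Fin m → Fin d → ℝ) × ((j : Fin m) → Fin (nt j) → Fin d → ℝ) ×
    ((j : Fin m) → Fin (nt j) → ℝ) × (Fin n → Fin d → ℝ) × (Fin n → ℝ) × (Fin d → ℝ) × ℝ

/-- The estimation error for full-rank designs, a linear form in the target parameter and in the
noises. -/
def estimationError {m d n : ℕ} {nt : Fin m → ℕ} (H : Fin m → Matrix (Fin d) (Fin d) ℝ) (α : ℝ)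
    (t : DataTuple m d n nt) : Fin d → ℝ :=
  biasCoeff H α (Matrix.of t.2.2.2.2.1) (fun j => Matrix.of (t.2.2.1 j)) *ᵥ t.1
    + ∑ j, taskCoeff H α (Matrix.of t.2.2.2.2.1) (fun j => Matrix.of (t.2.2.1 j)) j *ᵥ t.2.1 j
    + ∑ j, sourceCoeff H α (Matrix.of t.2.2.2.2.1) (fun j => Matrix.of (t.2.2.1 j)) j
        *ᵥ t.2.2.2.1 j
    + ((ridge m (Matrix.of t.2.2.2.2.1) α)⁻¹ * (Matrix.of t.2.2.2.2.1)ᵀ) *ᵥ t.2.2.2.2.2.1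

/-- The prediction error on the test example for full-rank designs. -/
def linearError {m d n : ℕ} {nt : Fin m → ℕ} (H : Fin m → Matrix (Fin d) (Fin d) ℝ) (α : ℝ)
    (t : DataTuple m d n nt) : ℝ :=
  t.2.2.2.2.2.2.1 ⬝ᵥ estimationError H α t - t.2.2.2.2.2.2.2

theorem measurable_estimationError {m d n : ℕ} {nt : Fin m → ℕ}
    (H : Fin m → Matrix (Fin d) (Fin d) ℝ) (α : ℝ) :
    Measurable fun t : DataTuple m d n nt => estimationError H α t := by
  have hX : ∀ i k, Measurable fun t : DataTuple m d n nt => Matrix.of t.2.2.2.2.1 i k := by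
    intro i k
    simp only [Matrix.of_apply]
    fun_prop
  have hZ : Measurable fun (t : DataTuple m d n nt) (j : Fin m) (i : Fin (nt j)) (k : Fin d) =>
      Matrix.of (t.2.2.1 j) i k := by
    simp only [Matrix.of_apply]
    fun_prop
  unfold estimationError
  refine ((Measurable.add ?_ (Finset.measurable_fun_sum _ fun j _ => ?_)).add
    (Finset.measurable_fun_sum _ fun j _ => ?_)).add ?_
  · exact measurable_mulVec (measurable_biasCoeff H α hX hZ) (by fun_prop)
  · exact measurable_mulVec (measurable_taskCoeff H α hX hZ j) (by fun_prop)
  · exact measurable_mulVec (measurable_sourceCoeff H α hX hZ j) (by fun_prop)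
  · exact measurable_mulVec (measurable_inv_ridge_mul (m := m) hX α) (by fun_prop)

theorem measurable_linearError {m d n : ℕ} {nt : Fin m → ℕ}
    (H : Fin m → Matrix (Fin d) (Fin d) ℝ) (α : ℝ) :
    Measurable fun t : DataTuple m d n nt => linearError H α t := by
  unfold linearError dotProduct
  have := measurable_estimationError (n := n) (nt := nt) H α
  fun_prop

section TestError

variable {Ω : Type*} [MeasurableSpace Ω] {P : Measure Ω} {m d n : ℕ} {nt : Fin m → ℕ} {b σε : ℝ}
  {ση σξ : Fin m → ℝ} {νx : Measure (Fin d → ℝ)} {νε : Measure ℝ} {νξ : Fin m → Measure ℝ}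
  {S : Ω → Sample m d n nt}

theorem hasLaw_X [IsProbabilityMeasure νx] [IsProbabilityMeasure νε]
    [∀ j, IsProbabilityMeasure (νξ j)]
    (hS : HasLaw (fun ω => (S ω).toTuple) (jointLaw m d n nt b ση νξ νx νε) P) :
    HasLaw (fun ω => ((S ω).X : Fin n → Fin d → ℝ)) (Measure.pi fun _ : Fin n => νx) P := by
  have h : MeasurePreserving (fun t : DataTuple m d n nt => t.2.2.2.2.1)
      (jointLaw m d n nt b ση νξ νx νε) (Measure.pi fun _ : Fin n => νx) :=
    measurePreserving_fst.comp <| measurePreserving_snd.comp <| measurePreserving_snd.comp <|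
      measurePreserving_snd.comp measurePreserving_snd
  exact h.fun_comp_hasLaw hS

theorem hasLaw_Z [IsProbabilityMeasure νx] [IsProbabilityMeasure νε]
    [∀ j, IsProbabilityMeasure (νξ j)]
    (hS : HasLaw (fun ω => (S ω).toTuple) (jointLaw m d n nt b ση νξ νx νε) P) :
    HasLaw (𝓧 := (j : Fin m) → Fin (nt j) → Fin d → ℝ) (fun ω => (S ω).Z)
      (Measure.pi fun j => gaussianMatrix (nt j) d) P := by
  have h : MeasurePreserving (fun t : DataTuple m d n nt => t.2.2.1)
      (jointLaw m d n nt b ση νξ νx νε) (Measure.pi fun j => gaussianMatrix (nt j) d) :=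
    measurePreserving_fst.comp <| measurePreserving_snd.comp measurePreserving_snd
  exact h.fun_comp_hasLaw hS

theorem testError_eq_lintegral_condError (hb : 0 ≤ b) (hνx : IsIsotropic νx)
    (hνε : IsNoise νε (σε ^ 2)) (hνξ : ∀ j, IsNoise (νξ j) (σξ j ^ 2))
    (hS : HasLaw (fun ω => (S ω).toTuple) (jointLaw m d n nt b ση νξ νx νε) P)
    (H : Fin m → Matrix (Fin d) (Fin d) ℝ) (horth : ∀ j, (H j)ᵀ * H j = 1) (α : ℝ)
    (hK : ∀ᵐ X ∂(Measure.pi fun _ : Fin n => νx), IsUnit (ridge m (Matrix.of X) α)) :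
    testError P S H H α = ∫⁻ X, ∫⁻ Z, ENNReal.ofReal
      (condError H α (Matrix.of X) (fun j => Matrix.of (Z j)) b σε ση σξ)
      ∂(Measure.pi fun j => gaussianMatrix (nt j) d) ∂(Measure.pi fun _ : Fin n => νx) := by
  have := hνx.prob
  have := hνε.prob
  have := fun j => (hνξ j).prob
  have h1 : testError P S H H α = ∫⁻ ω, ENNReal.ofReal (linearError H α (S ω).toTuple ^ 2) ∂P := by
    refine lintegral_congr_ae ?_
    have hXae : ∀ᵐ ω ∂P, IsUnit (ridge m (S ω).X α) := by
      have h := hasLaw_X hS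
      rw [← h.map_eq] at hK
      exact ae_of_ae_map h.aemeasurable hK
    have hZae : ∀ᵐ ω ∂P, ∀ j, pinv ((S ω).Z j) = fullRankPinv ((S ω).Z j) := by
      have h := hasLaw_Z hS
      have h0 : ∀ᵐ Z ∂(Measure.pi fun j => gaussianMatrix (nt j) d), ∀ j,
          pinv (Matrix.of (Z j)) = fullRankPinv (Matrix.of (Z j)) := by
        rw [ae_all_iff]
        intro j
        exact (Measure.quasiMeasurePreserving_eval (fun j => gaussianMatrix (nt j) d) j).ae
          (ae_pinv_eq_fullRankPinv (nt j) d)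
      rw [← h.map_eq] at h0
      exact ae_of_ae_map h.aemeasurable h0
    filter_upwards [hXae, hZae] with ω hω1 hω2
    rw [sq_prediction_error_eq (S ω) H horth α hω1 hω2]
    rfl
  have hFm : Measurable fun t : DataTuple m d n nt => ENNReal.ofReal (linearError H α t ^ 2) :=
    ENNReal.measurable_ofReal.comp ((measurable_linearError H α).pow_const 2)
  rw [h1, hS.lintegral_comp (f := fun t : DataTuple m d n nt =>
    ENNReal.ofReal (linearError H α t ^ 2)) hFm.aemeasurable, jointLaw,
    lintegral_prod_reorder _ _ _ _ _ _ _ _ hFm]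
  simp only [gaussianMatrix]
  refine lintegral_congr fun X => lintegral_congr fun Z => ?_
  have h := lintegral_sq_linear_error (ση := ση) hb hνx hνε hνξ
    ((ridge m (Matrix.of X) α)⁻¹ * (Matrix.of X)ᵀ)
    (biasCoeff H α (Matrix.of X) fun j => Matrix.of (Z j))
    (taskCoeff H α (Matrix.of X) fun j => Matrix.of (Z j))
    (sourceCoeff H α (Matrix.of X) fun j => Matrix.of (Z j))
  rw [condError, ← h]
  rfl

end TestError

/-! ### Averaging over the source designs -/

theorem sqFrob_eq_trace {p q : ℕ} (A : Matrix (Fin p) (Fin q) ℝ) :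
    sqFrob A = (A * Aᵀ).trace := by
  simp only [sqFrob, Matrix.trace, Matrix.diag_apply, Matrix.mul_apply, Matrix.transpose_apply, sq]
  exact Finset.sum_comm

theorem sqFrob_smul {p q : ℕ} (c : ℝ) (A : Matrix (Fin p) (Fin q) ℝ) :
    sqFrob (c • A) = c ^ 2 * sqFrob A := by
  simp only [sqFrob, Matrix.smul_apply, smul_eq_mul, mul_pow, Finset.mul_sum]

theorem sqFrob_mul_le {p q r : ℕ} (A : Matrix (Fin p) (Fin q) ℝ) (B : Matrix (Fin q) (Fin r) ℝ) :
    sqFrob (A * B) ≤ sqFrob A * sqFrob B := by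
  have h : ∀ j i, (A * B) i j ^ 2 ≤ (∑ k, A i k ^ 2) * ∑ k, B k j ^ 2 := fun j i => by
    rw [Matrix.mul_apply]
    exact Finset.sum_mul_sq_le_sq_mul_sq _ _ _
  calc sqFrob (A * B) ≤ ∑ j, ∑ i, (∑ k, A i k ^ 2) * ∑ k, B k j ^ 2 :=
        Finset.sum_le_sum fun j _ => Finset.sum_le_sum fun i _ => h j i
    _ = sqFrob A * sqFrob B := by
        simp only [sqFrob]
        rw [Finset.sum_comm (f := fun j i => A i j ^ 2), Finset.mul_sum]
        exact Finset.sum_congr rfl fun j _ => (Finset.sum_mul _ _ _).symm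

theorem HasMean.mul_of_ne {m : ℕ} {Ω : Fin m → Type*} [∀ j, MeasurableSpace (Ω j)]
    {μ : (j : Fin m) → Measure (Ω j)} [∀ j, IsProbabilityMeasure (μ j)] {p q r : ℕ} {j l : Fin m}
    (hjl : j ≠ l) {F : Ω j → Matrix (Fin p) (Fin q) ℝ} {M : Matrix (Fin p) (Fin q) ℝ}
    {G : Ω l → Matrix (Fin q) (Fin r) ℝ} {N : Matrix (Fin q) (Fin r) ℝ}
    (hF : HasMean (μ j) F M) (hG : HasMean (μ l) G N) :
    HasMean (Measure.pi μ) (fun ω => F (ω j) * G (ω l)) (M * N) := by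
  have hF' := hF.comp_measurePreserving (measurePreserving_eval μ j)
  have hG' := hG.comp_measurePreserving (measurePreserving_eval μ l)
  have hind : ∀ i k i' k', IndepFun (fun ω : (j : Fin m) → Ω j => F (ω j) i k)
      (fun ω => G (ω l) i' k') (Measure.pi μ) := by
    intro i k i' k'
    have h0 := (iIndepFun_pi (μ := μ) (X := fun j ω => ω) fun j => aemeasurable_id).indepFun hjl
    exact h0.comp₀ (φ := fun x => F x i k) (ψ := fun x => G x i' k')
      (measurable_pi_apply j).aemeasurable (measurable_pi_apply l).aemeasurable
      (by rw [(measurePreserving_eval μ j).map_eq]; exact (hF i k).1.aemeasurable)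
      (by rw [(measurePreserving_eval μ l).map_eq]; exact (hG i' k').1.aemeasurable)
  intro i k
  have hi : ∀ t, Integrable (fun ω => F (ω j) i t * G (ω l) t k) (Measure.pi μ) := fun t =>
    (hind i t t k).integrable_mul (hF' i t).1 (hG' t k).1
  simp only [Matrix.mul_apply]
  refine ⟨integrable_finsetSum _ fun t _ => hi t, ?_⟩
  rw [integral_finsetSum _ fun t _ => hi t]
  refine Finset.sum_congr rfl fun t _ => ?_
  rw [(hind i t t k).integral_fun_mul_eq_mul_integral (hF' i t).1.aestronglyMeasurable
    (hG' t k).1.aestronglyMeasurable]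
  exact congrArg₂ (· * ·) (hF' i t).2 (hG' t k).2

/-- If `E B Bᵀ` is scalar then the mean of `‖c G B‖²` is proportional to `‖G‖²`. -/
theorem HasMean.integral_sqFrob {Ω : Type*} [MeasurableSpace Ω] {μ : Measure Ω} {p q r : ℕ}
    {B : Ω → Matrix (Fin p) (Fin q) ℝ} {k : ℝ} (h : HasMean μ (fun ω => B ω * (B ω)ᵀ) (k • 1))
    (c : ℝ) (G : Matrix (Fin r) (Fin p) ℝ) :
    Integrable (fun ω => sqFrob (c • (G * B ω))) μ ∧
      ∫ ω, sqFrob (c • (G * B ω)) ∂μ = c ^ 2 * (k * sqFrob G) := by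
  have e : ∀ ω, sqFrob (c • (G * B ω)) = c ^ 2 * (G * (B ω * (B ω)ᵀ) * Gᵀ).trace := fun ω => by
    rw [sqFrob_smul, sqFrob_eq_trace, Matrix.transpose_mul]
    simp only [Matrix.mul_assoc]
  simp only [e]
  have h' := (h.const_mul G).mul_const Gᵀ
  refine ⟨h'.integrable_trace.const_mul _, ?_⟩
  rw [integral_const_mul, h'.integral_trace, sqFrob_eq_trace]
  simp [Matrix.trace_smul]

/-- The mean of `Dⱼ Dₗᵀ` is this multiple of the identity, where `Dⱼ` is the bias of source `j`. -/
def biasCov {m : ℕ} (d : ℕ) (nt : Fin m → ℕ) (j l : Fin m) : ℝ :=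
  if j = l then 1 - biasFactor d (nt j)
    else (1 - biasFactor d (nt j)) * (1 - biasFactor d (nt l))

/-- The second moment of the aggregated source estimates around the target parameter, per
coordinate: the real number whose finite value is `totalConst`. -/
def sourceMoment {m : ℕ} (d : ℕ) (nt : Fin m → ℕ) (b : ℝ) (ση σξ : Fin m → ℝ) : ℝ :=
  ∑ j, σξ j ^ 2 * noiseFactor d (nt j) + ∑ j, ση j ^ 2 / d * biasFactor d (nt j)
    + b / d * ∑ j, ∑ l, biasCov d nt j l

section SourceDesigns

variable {m d n : ℕ} {nt : Fin m → ℕ} {H : Fin m → Matrix (Fin d) (Fin d) ℝ}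

/-- `Z⁺ Z` is an orthogonal projection. -/
theorem ae_projection (p d : ℕ) : ∀ᵐ Z ∂gaussianMatrix p d,
    (fullRankPinv (Matrix.of Z) * Matrix.of Z)ᵀ = fullRankPinv (Matrix.of Z) * Matrix.of Z ∧
    (fullRankPinv (Matrix.of Z) * Matrix.of Z) * (fullRankPinv (Matrix.of Z) * Matrix.of Z)
      = fullRankPinv (Matrix.of Z) * Matrix.of Z := by
  filter_upwards [ae_pinv_eq_fullRankPinv p d] with Z hZ
  rw [← hZ]
  refine ⟨pinv_mul_symm _, ?_⟩
  rw [← Matrix.mul_assoc, pinv_mul_pinv]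

theorem hasMean_source (hd : 0 < d) (hnt : ∀ j, 0 < nt j) (horth : ∀ j, (H j)ᵀ * H j = 1)
    (j : Fin m) (h : d + 2 ≤ nt j ∨ nt j + 2 ≤ d) :
    HasMean (Measure.pi fun j => gaussianMatrix (nt j) d)
      (fun Z => ((H j)ᵀ * fullRankPinv (Matrix.of (Z j))) *
        ((H j)ᵀ * fullRankPinv (Matrix.of (Z j)))ᵀ) (noiseFactor d (nt j) • 1) := by
  have h1 := (((hasMean_pinv_mul_transpose hd (hnt j) h).const_mul (H j)ᵀ).mul_const (H j))
  have h2 := h1.comp_measurePreserving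
    (measurePreserving_eval (fun j => gaussianMatrix (nt j) d) j)
  simp only [Matrix.mul_smul, Matrix.smul_mul, Matrix.mul_one, horth] at h2
  refine h2.congr (ae_of_all _ fun Z => ?_)
  simp only [Matrix.transpose_mul, Matrix.transpose_transpose, Matrix.mul_assoc, Function.eval]

theorem hasMean_task (hd : 0 < d) (horth : ∀ j, (H j)ᵀ * H j = 1) (j : Fin m) :
    HasMean (Measure.pi fun j => gaussianMatrix (nt j) d)
      (fun Z => ((H j)ᵀ * (fullRankPinv (Matrix.of (Z j)) * Matrix.of (Z j))) *
        ((H j)ᵀ * (fullRankPinv (Matrix.of (Z j)) * Matrix.of (Z j)))ᵀ)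
      (biasFactor d (nt j) • 1) := by
  have h1 := (((hasMean_pinv_mul_self (p := nt j) hd).const_mul (H j)ᵀ).mul_const (H j))
  have h1' := h1.congr (G := fun Z => ((H j)ᵀ * (fullRankPinv (Matrix.of Z) * Matrix.of Z)) *
        ((H j)ᵀ * (fullRankPinv (Matrix.of Z) * Matrix.of Z))ᵀ) <| by
    filter_upwards [ae_projection (nt j) d] with Z ⟨hs, hi⟩
    generalize fullRankPinv (Matrix.of Z) * Matrix.of Z = Q at hs hi
    rw [Matrix.transpose_mul, hs, Matrix.transpose_transpose]
    calc (H j)ᵀ * Q * H j = (H j)ᵀ * (Q * Q) * H j := by rw [hi]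
      _ = _ := by simp only [Matrix.mul_assoc]
  have h2 := h1'.comp_measurePreserving
    (measurePreserving_eval (fun j => gaussianMatrix (nt j) d) j)
  simp only [Matrix.mul_smul, Matrix.smul_mul, Matrix.mul_one, horth] at h2
  exact h2

/-- The bias `Dⱼ` of source `j` is minus an orthogonal projection, so the diagonal terms of the
double sum are means of projections; the other terms factor by independence. -/
theorem hasMean_bias (hd : 0 < d) (horth : ∀ j, (H j)ᵀ * H j = 1) :
    HasMean (Measure.pi fun j => gaussianMatrix (nt j) d)
      (fun Z =>
        (∑ j, ((H j)ᵀ * (fullRankPinv (Matrix.of (Z j)) * Matrix.of (Z j)) * H j - 1)) *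
        (∑ j, ((H j)ᵀ * (fullRankPinv (Matrix.of (Z j)) * Matrix.of (Z j)) * H j - 1))ᵀ)
      ((∑ j, ∑ l, biasCov d nt j l) • 1) := by
  set D : (j : Fin m) → (Fin (nt j) → Fin d → ℝ) → Matrix (Fin d) (Fin d) ℝ := fun j Z =>
    (H j)ᵀ * (fullRankPinv (Matrix.of Z) * Matrix.of Z) * H j - 1 with hD
  have hDm : ∀ j, HasMean (gaussianMatrix (nt j) d) (D j) ((biasFactor d (nt j) - 1) • 1) := by
    intro j
    have h := (((hasMean_pinv_mul_self (p := nt j) hd).const_mul (H j)ᵀ).mul_const (H j)).sub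
      (HasMean.const 1)
    simpa only [Matrix.mul_smul, Matrix.smul_mul, Matrix.mul_one, horth, sub_smul, one_smul] using h
  have hDt : ∀ j, ∀ᵐ Z ∂gaussianMatrix (nt j) d, (D j Z)ᵀ = D j Z ∧ D j Z * D j Z = -D j Z := by
    intro j
    filter_upwards [ae_projection (nt j) d] with Z ⟨hs, hi⟩
    have hH : H j * (H j)ᵀ = 1 := mul_eq_one_comm.1 (horth j)
    simp only [hD]
    generalize fullRankPinv (Matrix.of Z) * Matrix.of Z = Q at hs hi
    refine ⟨?_, ?_⟩
    · simp only [Matrix.transpose_sub, Matrix.transpose_mul, hs, Matrix.transpose_transpose,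
        Matrix.transpose_one, Matrix.mul_assoc]
    · have e : ((H j)ᵀ * Q * H j) * ((H j)ᵀ * Q * H j) = (H j)ᵀ * Q * H j := by
        calc _ = (H j)ᵀ * (Q * ((H j * (H j)ᵀ) * Q)) * H j := by simp only [Matrix.mul_assoc]
          _ = _ := by rw [hH, Matrix.one_mul, hi]
      rw [Matrix.sub_mul, Matrix.mul_sub, Matrix.mul_sub, e]
      simp
  have hjl : ∀ j l, HasMean (Measure.pi fun j => gaussianMatrix (nt j) d)
      (fun Z => D j (Z j) * (D l (Z l))ᵀ) (biasCov d nt j l • 1) := by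
    intro j l
    unfold biasCov
    split_ifs with hj
    · subst hj
      have h0 : HasMean (gaussianMatrix (nt j) d) (fun Z => D j Z * (D j Z)ᵀ)
          ((1 - biasFactor d (nt j)) • 1) := by
        have := (hDm j).smul (-1)
        rw [smul_smul, neg_one_mul, neg_sub] at this
        refine this.congr ?_
        filter_upwards [hDt j] with Z ⟨h1, h2⟩
        rw [h1, h2, neg_one_smul]
      exact h0.comp_measurePreserving
        (measurePreserving_eval (fun j => gaussianMatrix (nt j) d) j)
    · have h := HasMean.mul_of_ne (μ := fun j => gaussianMatrix (nt j) d) hj (hDm j)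
        ((hDm l).congr (G := fun Z => (D l Z)ᵀ) ((hDt l).mono fun Z hZ => hZ.1.symm))
      rw [Matrix.smul_mul, Matrix.one_mul, smul_smul] at h
      convert h using 2
      ring
  have h := HasMean.sum Finset.univ fun j _ => HasMean.sum Finset.univ fun l _ => hjl j l
  simp only [← Finset.sum_smul] at h
  refine h.congr (ae_of_all _ fun Z => ?_)
  rw [Matrix.transpose_sum, Finset.sum_mul_sum]

/-- The test error conditional on the target design, away from the interpolation thresholds of the
source tasks. -/
theorem lintegral_condError (hd : 0 < d) (hnt : ∀ j, 0 < nt j) (horth : ∀ j, (H j)ᵀ * H j = 1)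
    (hfin : ∀ j, d + 2 ≤ nt j ∨ nt j + 2 ≤ d) {b : ℝ} (hb : 0 ≤ b) (σε : ℝ) (ση σξ : Fin m → ℝ)
    (α : ℝ) (X : Matrix (Fin n) (Fin d) ℝ) :
    ∫⁻ Z, ENNReal.ofReal (condError H α X (fun j => Matrix.of (Z j)) b σε ση σξ)
      ∂(Measure.pi fun j => gaussianMatrix (nt j) d)
    = ENNReal.ofReal (σε ^ 2 + σε ^ 2 * sqFrob ((ridge m X α)⁻¹ * Xᵀ)
        + (n * α) ^ 2 * sourceMoment d nt b ση σξ * sqFrob (ridge m X α)⁻¹) := by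
  set G := (ridge m X α)⁻¹ with hG
  have h4 := fun j => (hasMean_source hd hnt horth j (hfin j)).integral_sqFrob (n * α) G
  have h3 := fun j => (hasMean_task (nt := nt) hd horth j).integral_sqFrob (n * α) G
  have h2 := (hasMean_bias (nt := nt) hd horth).integral_sqFrob (n * α) G
  have i4 := integrable_finsetSum Finset.univ fun j _ => (h4 j).1.const_mul (σξ j ^ 2)
  have i3 := integrable_finsetSum Finset.univ fun j _ => (h3 j).1.const_mul (ση j ^ 2 / d)
  have i2 := h2.1.const_mul (b / d)
  have i1 : Integrable (fun _ : (j : Fin m) → Fin (nt j) → Fin d → ℝ =>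
      σε ^ 2 + σε ^ 2 * sqFrob (G * Xᵀ)) (Measure.pi fun j => gaussianMatrix (nt j) d) :=
    integrable_const _
  have key := ((integral_add ((i1.add i4).add i3) i2).trans
    (congrArg (· + _) ((integral_add (i1.add i4) i3).trans
      (congrArg (· + _) (integral_add i1 i4)))))
  have hint : Integrable (fun Z : (j : Fin m) → Fin (nt j) → Fin d → ℝ =>
      condError H α X (fun j => Matrix.of (Z j)) b σε ση σξ)
      (Measure.pi fun j => gaussianMatrix (nt j) d) := ((i1.add i4).add i3).add i2
  rw [← ofReal_integral_eq_lintegral_ofReal hint]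
  · congr 1
    refine key.trans ?_
    rw [integral_finsetSum _ fun j _ => (h4 j).1.const_mul (σξ j ^ 2),
      integral_finsetSum _ fun j _ => (h3 j).1.const_mul (ση j ^ 2 / d)]
    simp only [integral_const_mul, (h4 _).2, (h3 _).2, h2.2, integral_const, probReal_univ,
      one_smul, sourceMoment]
    have e : ∀ c r : Fin m → ℝ, ∑ j, c j * ((n * α) ^ 2 * (r j * sqFrob G))
        = (n * α) ^ 2 * (∑ j, c j * r j) * sqFrob G := fun c r => by
      rw [Finset.mul_sum, Finset.sum_mul]
      exact Finset.sum_congr rfl fun j _ => by ring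
    rw [e, e]
    ring
  · refine ae_of_all _ fun Z => ?_
    have s1 : ∀ {p q : ℕ} (c : ℝ) (A : Matrix (Fin p) (Fin q) ℝ), 0 ≤ c → 0 ≤ c * sqFrob A :=
      fun c A hc => mul_nonneg hc (sqFrob_nonneg A)
    refine add_nonneg (add_nonneg (add_nonneg (add_nonneg (sq_nonneg _) (s1 _ _ (sq_nonneg _)))
      ?_) ?_) (s1 _ _ (by positivity))
    · exact Finset.sum_nonneg fun j _ => s1 _ _ (sq_nonneg _)
    · exact Finset.sum_nonneg fun j _ => s1 _ _ (by positivity)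

/-- The test error conditional on the target design is infinite if a noisy source task is at its
interpolation threshold. -/
theorem lintegral_condError_eq_top (hd : 0 < d) (hn : 0 < n) (hnt : ∀ j, 0 < nt j)
    (horth : ∀ j, (H j)ᵀ * H j = 1) {j : Fin m} (hj : ¬ d + 2 ≤ nt j ∧ ¬ nt j + 2 ≤ d)
    {b : ℝ} (hb : 0 ≤ b) (σε : ℝ) (ση σξ : Fin m → ℝ) (hσ : 0 < σξ j)
    {α : ℝ} (hα : 0 < α) (X : Matrix (Fin n) (Fin d) ℝ) (hK : IsUnit (ridge m X α)) :
    ∫⁻ Z, ENNReal.ofReal (condError H α X (fun j => Matrix.of (Z j)) b σε ση σξ)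
      ∂(Measure.pi fun j => gaussianMatrix (nt j) d) = ⊤ := by
  set G := (ridge m X α)⁻¹ with hG
  have hdet := (Matrix.isUnit_iff_isUnit_det _).1 hK
  have hs : (0 : ℝ) < n * α := by positivity
  set C := sqFrob (H j * ridge m X α) with hC
  have hC0 : 0 ≤ C := sqFrob_nonneg _
  have hH : H j * (H j)ᵀ = 1 := mul_eq_one_comm.1 (horth j)
  -- the term of the noise of source `j` alone dominates a multiple of `‖Zⱼ⁺‖²`
  have hle : ∀ Z : (j : Fin m) → Fin (nt j) → Fin d → ℝ,
      (fullRankPinv (Matrix.of (Z j)) * (fullRankPinv (Matrix.of (Z j)))ᵀ).trace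
        ≤ C / (σξ j ^ 2 * (n * α) ^ 2) *
          condError H α X (fun j => Matrix.of (Z j)) b σε ση σξ := by
    intro Z
    have h1 : σξ j ^ 2 * sqFrob (sourceCoeff H α X (fun j => Matrix.of (Z j)) j)
        ≤ condError H α X (fun j => Matrix.of (Z j)) b σε ση σξ := by
      have s1 : ∀ {p q : ℕ} (c : ℝ) (A : Matrix (Fin p) (Fin q) ℝ), 0 ≤ c → 0 ≤ c * sqFrob A :=
        fun c A hc => mul_nonneg hc (sqFrob_nonneg A)
      have t1 := s1 (σε ^ 2) ((ridge m X α)⁻¹ * Xᵀ) (sq_nonneg _)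
      have t2 := s1 (b / d) (biasCoeff H α X (fun j => Matrix.of (Z j))) (by positivity)
      have t3 : 0 ≤ ∑ j, ση j ^ 2 / d * sqFrob (taskCoeff H α X (fun j => Matrix.of (Z j)) j) :=
        Finset.sum_nonneg fun j _ => s1 _ _ (by positivity)
      have t4 := Finset.single_le_sum
        (f := fun j => σξ j ^ 2 * sqFrob (sourceCoeff H α X (fun j => Matrix.of (Z j)) j))
        (fun j _ => s1 _ _ (sq_nonneg _)) (Finset.mem_univ j)
      have t5 := sq_nonneg σε
      unfold condError
      linarith
    have h2 : sqFrob (fullRankPinv (Matrix.of (Z j)))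
        ≤ C * sqFrob (G * ((H j)ᵀ * fullRankPinv (Matrix.of (Z j)))) := by
      have e : fullRankPinv (Matrix.of (Z j))
          = (H j * ridge m X α) * (G * ((H j)ᵀ * fullRankPinv (Matrix.of (Z j)))) := by
        rw [Matrix.mul_assoc, ← Matrix.mul_assoc (ridge m X α), Matrix.mul_nonsing_inv _ hdet,
          Matrix.one_mul, ← Matrix.mul_assoc, hH, Matrix.one_mul]
      conv_lhs => rw [e]
      exact sqFrob_mul_le _ _
    rw [← sqFrob_eq_trace]
    refine h2.trans ?_
    rw [sourceCoeff, sqFrob_smul] at h1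
    have h3 := mul_le_mul_of_nonneg_left h1
      (by positivity : 0 ≤ C / (σξ j ^ 2 * (n * α) ^ 2))
    refine le_trans (le_of_eq ?_) h3
    rw [← hG]
    field_simp
  have htop : ∫⁻ Z, ENNReal.ofReal
      (fullRankPinv (Matrix.of (Z j)) * (fullRankPinv (Matrix.of (Z j)))ᵀ).trace
      ∂(Measure.pi fun j => gaussianMatrix (nt j) d) = ⊤ := by
    have h := lintegral_trace_pinv hd (hnt j)
    rw [if_neg hj.1, if_neg hj.2] at h
    rw [← h]
    refine (measurePreserving_eval (fun j => gaussianMatrix (nt j) d) j).lintegral_comp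
      (f := fun Z => ENNReal.ofReal
        (fullRankPinv (Matrix.of Z) * (fullRankPinv (Matrix.of Z))ᵀ).trace) ?_
    refine ENNReal.measurable_ofReal.comp (Finset.measurable_sum _ fun i _ => ?_)
    exact measurable_matrix_mul measurable_fullRankPinv
      (fun i j => measurable_fullRankPinv j i) i i
  by_contra hne
  have hfin := ENNReal.mul_ne_top
    (ENNReal.ofReal_ne_top (r := C / (σξ j ^ 2 * (n * α) ^ 2))) hne
  rw [← lintegral_const_mul' _ _ ENNReal.ofReal_ne_top] at hfin
  apply hfin
  rw [← top_le_iff, ← htop]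
  refine lintegral_mono fun Z => ?_
  rw [← ENNReal.ofReal_mul (by positivity)]
  exact ENNReal.ofReal_le_ofReal (hle Z)

end SourceDesigns

/-! ### The constants -/

theorem biasFactor_le_one (d p : ℕ) : biasFactor d p ≤ 1 := by
  unfold biasFactor
  split_ifs with h
  · exact le_rfl
  · exact div_le_one_of_le₀ (by exact_mod_cast (not_le.1 h).le) (by positivity)

theorem biasFactor_nonneg (d p : ℕ) : 0 ≤ biasFactor d p := by
  unfold biasFactor; split_ifs <;> positivity

theorem sourceConst_ne_top_iff (d p : ℕ) (b ση σξ : ℝ) :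
    sourceConst d p b ση σξ ≠ ⊤ ↔ d + 2 ≤ p ∨ p + 2 ≤ d := by
  unfold sourceConst
  split_ifs <;> simp [*]

theorem noiseFactor_nonneg {d p : ℕ} (h : d + 2 ≤ p ∨ p + 2 ≤ d) : 0 ≤ noiseFactor d p := by
  unfold noiseFactor
  split_ifs with h1
  · have : (d : ℝ) + 2 ≤ p := by exact_mod_cast h1
    exact div_nonneg zero_le_one (by linarith)
  · have : (p : ℝ) + 2 ≤ d := by exact_mod_cast h.resolve_left h1
    exact mul_nonneg (by positivity) (div_nonneg zero_le_one (by linarith))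

theorem sourceConst_eq {d p : ℕ} (hd : 0 < d) (b ση σξ : ℝ) (h : d + 2 ≤ p ∨ p + 2 ≤ d) :
    sourceConst d p b ση σξ = ENNReal.ofReal
      (σξ ^ 2 * noiseFactor d p + ση ^ 2 / d * biasFactor d p + b / d * (1 - biasFactor d p)) := by
  have hd' : (d : ℝ) ≠ 0 := by positivity
  unfold sourceConst noiseFactor biasFactor
  by_cases h1 : d + 2 ≤ p
  · rw [if_pos h1, if_pos h1, if_pos (by omega)]
    congr 1; ring
  · rw [if_neg h1, if_neg h1, if_pos (h.resolve_left h1), if_neg (by omega)]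
    congr 1; ring

theorem totalConst_eq_ofReal {m d : ℕ} {nt : Fin m → ℕ} (hd : 0 < d) {b : ℝ} (hb : 0 ≤ b)
    (ση σξ : Fin m → ℝ) (hfin : ∀ j, d + 2 ≤ nt j ∨ nt j + 2 ≤ d) :
    totalConst d nt b ση σξ = ENNReal.ofReal (sourceMoment d nt b ση σξ) := by
  have hc : ∀ j, 0 ≤ 1 - biasFactor d (nt j) := fun j => sub_nonneg.2 (biasFactor_le_one _ _)
  have hoff : ∑ j, ∑ l, biasCov d nt j l = ∑ j, (1 - biasFactor d (nt j))
      + 2 * ∑ l, ∑ j ∈ Finset.Ioi l, (1 - biasFactor d (nt j)) * (1 - biasFactor d (nt l)) := by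
    have h1 := Finset.sum_sum_Ioi_add_eq_sum_sum_off_diag
      (fun j l => (1 - biasFactor d (nt j)) * (1 - biasFactor d (nt l)))
    have h2 : ∀ j, ∑ l, biasCov d nt j l = (1 - biasFactor d (nt j))
        + ∑ l ∈ {j}ᶜ, (1 - biasFactor d (nt l)) * (1 - biasFactor d (nt j)) := by
      intro j
      rw [← Finset.sum_add_sum_compl {j}, Finset.sum_singleton, biasCov, if_pos rfl]
      congr 1
      refine Finset.sum_congr rfl fun l hl => ?_
      rw [Finset.mem_compl, Finset.mem_singleton] at hl
      rw [biasCov, if_neg (Ne.symm hl), mul_comm]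
    simp only [h2, Finset.sum_add_distrib]
    rw [← h1]
    congr 1
    simp only [Finset.mul_sum]
    exact Finset.sum_congr rfl fun l _ => Finset.sum_congr rfl fun j _ => by ring
  rw [totalConst]
  simp only [fun j => sourceConst_eq hd b (ση j) (σξ j) (hfin j)]
  rw [← ENNReal.ofReal_sum_of_nonneg, ← ENNReal.ofReal_add]
  · congr 1
    rw [sourceMoment, hoff]
    rw [Finset.sum_add_distrib, Finset.sum_add_distrib, ← Finset.mul_sum]
    ring
  · refine Finset.sum_nonneg fun j _ => ?_
    have := hc j
    have := biasFactor_nonneg d (nt j)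
    have := noiseFactor_nonneg (hfin j)
    positivity
  · refine mul_nonneg (by positivity) (Finset.sum_nonneg fun l _ => Finset.sum_nonneg fun j _ =>
      mul_nonneg (hc j) (hc l))
  · intro j _
    have := hc j
    have := biasFactor_nonneg d (nt j)
    have := noiseFactor_nonneg (hfin j)
    positivity

/-! ### The optimal ridge parameter for a given target design -/

section Ridge

variable {d n : ℕ} (m : ℕ) (X : Matrix (Fin n) (Fin d) ℝ) {α : ℝ}

theorem posDef_ridge (hα : 0 < m * n * α) : (ridge m X α).PosDef := by
  have h1 : (Xᵀ * X).PosSemidef := Matrix.posSemidef_conjTranspose_mul_self X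
  have h2 : ((m * n * α) • (1 : Matrix (Fin d) (Fin d) ℝ)).PosDef := Matrix.PosDef.one.smul hα
  exact Matrix.PosDef.posSemidef_add h1 h2

theorem transpose_inv_ridge (α : ℝ) : ((ridge m X α)⁻¹)ᵀ = (ridge m X α)⁻¹ := by
  rw [Matrix.transpose_nonsing_inv]
  simp [ridge, Matrix.transpose_mul]

/-- The variance and the squared regularization bias of ridge regression add up to the trace of the
inverse of the regularized Gram matrix. -/
theorem sqFrob_inv_ridge_mul_add (hK : IsUnit (ridge m X α)) :
    sqFrob ((ridge m X α)⁻¹ * Xᵀ) + m * n * α * sqFrob (ridge m X α)⁻¹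
      = (ridge m X α)⁻¹.trace := by
  have hdet := (Matrix.isUnit_iff_isUnit_det _).1 hK
  have hG := transpose_inv_ridge m X α
  have e : ((ridge m X α)⁻¹ * Xᵀ) * ((ridge m X α)⁻¹ * Xᵀ)ᵀ
      + (m * n * α) • ((ridge m X α)⁻¹ * ((ridge m X α)⁻¹)ᵀ) = (ridge m X α)⁻¹ := by
    rw [Matrix.transpose_mul, Matrix.transpose_transpose, hG]
    calc _ = (ridge m X α)⁻¹ * ridge m X α * (ridge m X α)⁻¹ := by
          nth_rewrite 6 [ridge]
          simp only [Matrix.mul_add, Matrix.add_mul, Matrix.mul_assoc, Matrix.mul_smul,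
            Matrix.smul_mul, Matrix.mul_one]
      _ = _ := by rw [Matrix.nonsing_inv_mul _ hdet, Matrix.one_mul]
  rw [sqFrob_eq_trace, sqFrob_eq_trace, ← smul_eq_mul, ← Matrix.trace_smul, ← Matrix.trace_add, e]

theorem trace_inv_ridge_nonneg (hα : 0 ≤ m * n * α) (hK : IsUnit (ridge m X α)) :
    0 ≤ (ridge m X α)⁻¹.trace := by
  rw [← sqFrob_inv_ridge_mul_add m X hK]
  exact add_nonneg (sqFrob_nonneg _) (mul_nonneg hα (sqFrob_nonneg _))

/-- This bound makes the trace integrable whatever the law of the design. -/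
theorem trace_inv_ridge_le (hα : 0 < m * n * α) :
    (ridge m X α)⁻¹.trace ≤ d / (m * n * α) := by
  have hK := (posDef_ridge m X hα).isUnit
  have h1 := sqFrob_inv_ridge_mul_add m X hK
  have h0 := trace_inv_ridge_nonneg m X hα.le hK
  set G := (ridge m X α)⁻¹
  -- `(tr G)² ≤ d ‖G‖²` and `m n α ‖G‖² ≤ tr G`
  have h2 : G.trace ^ 2 ≤ d * sqFrob G := by
    calc G.trace ^ 2 ≤ d * ∑ i, G i i ^ 2 := by
          have := sq_sum_le_card_mul_sum_sq (s := Finset.univ) (f := fun i => G i i)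
          simpa [Matrix.trace] using this
      _ ≤ d * sqFrob G := by
          refine mul_le_mul_of_nonneg_left (Finset.sum_le_sum fun i _ => ?_) (by positivity)
          exact Finset.single_le_sum (f := fun k => G k i ^ 2) (fun k _ => sq_nonneg _)
            (Finset.mem_univ i)
  have h3 : m * n * α * sqFrob G ≤ G.trace := by linarith [sqFrob_nonneg (G * Xᵀ)]
  rw [le_div_iff₀ hα]
  by_contra hlt
  push Not at hlt
  have hd : (0 : ℝ) ≤ d := by positivity
  have ht : 0 < G.trace := by
    by_contra h
    have : G.trace = 0 := le_antisymm (not_lt.1 h) h0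
    rw [this] at hlt
    linarith
  nlinarith [mul_le_mul_of_nonneg_left h2 hα.le, mul_le_mul_of_nonneg_left h3 hd,
    mul_lt_mul_of_pos_left hlt ht]

/-- The test error for a given target design, averaged over all the other randomness; `A` is the
second moment of the aggregated source estimates. -/
def designError (σε A α : ℝ) : ℝ :=
  σε ^ 2 + σε ^ 2 * sqFrob ((ridge m X α)⁻¹ * Xᵀ)
    + (n * α) ^ 2 * A * sqFrob (ridge m X α)⁻¹

/-- At the parameter for which `n α A = m σε²`, only the first term remains. -/
theorem designError_eq (σε A : ℝ) (hK : IsUnit (ridge m X α)) :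
    designError m X σε A α = σε ^ 2 * (1 + (ridge m X α)⁻¹.trace)
      + n * α * (n * α * A - m * σε ^ 2) * sqFrob (ridge m X α)⁻¹ := by
  rw [← sqFrob_inv_ridge_mul_add m X hK, designError]
  ring

/-- The excess of the test error over its value at the optimal parameter `γ`, as an explicit
multiple of `(α - γ) ^ 2`. -/
theorem designError_sub (σε A : ℝ) {γ : ℝ} (hA : n * γ * A = m * σε ^ 2)
    (hα : IsUnit (ridge m X α)) (hγ : IsUnit (ridge m X γ)) :
    designError m X σε A α - designError m X σε A γ
      = A * n ^ 2 * (α - γ) ^ 2 *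
        ((X * (ridge m X α)⁻¹) * (ridge m X γ)⁻¹ * (X * (ridge m X α)⁻¹)ᵀ).trace := by
  have hdα := (Matrix.isUnit_iff_isUnit_det _).1 hα
  have hdγ := (Matrix.isUnit_iff_isUnit_det _).1 hγ
  have htα := transpose_inv_ridge m X α
  rw [designError_eq m X σε A hα, designError_eq m X σε A hγ, hA, sub_self, mul_zero, zero_mul,
    add_zero, sqFrob_eq_trace, Matrix.transpose_mul, htα]
  set G := (ridge m X α)⁻¹ with hG
  set G' := (ridge m X γ)⁻¹ with hG'
  -- the resolvent identity
  have hres : G - G' = (m * n * (γ - α)) • (G * G') := by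
    have h1 : ridge m X γ - ridge m X α
        = (m * n * (γ - α)) • (1 : Matrix (Fin d) (Fin d) ℝ) := by
      simp only [ridge, add_sub_add_left_eq_sub, ← sub_smul]
      congr 1; ring
    have h2 := congrArg (fun M => G * M * G') h1
    simpa [Matrix.mul_sub, Matrix.sub_mul, hG, hG', Matrix.nonsing_inv_mul _ hdα,
      Matrix.mul_assoc, Matrix.mul_nonsing_inv _ hdγ] using h2
  have e1 : G.trace - G'.trace = m * n * (γ - α) * (G * G').trace := by
    rw [← Matrix.trace_sub, hres, Matrix.trace_smul, smul_eq_mul]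
  have e2 : (G * G).trace - (G * G').trace = m * n * (γ - α) * (G * G' * G).trace := by
    rw [← Matrix.trace_sub, ← Matrix.mul_sub, hres, Matrix.mul_smul, Matrix.trace_smul,
      smul_eq_mul, Matrix.trace_mul_comm G]
  have hGX : G * (Xᵀ * X) = 1 - (m * n * α) • G := by
    have h1 : G * ridge m X α = 1 := Matrix.nonsing_inv_mul _ hdα
    rw [ridge, Matrix.mul_add, Matrix.mul_smul, Matrix.mul_one] at h1
    exact eq_sub_of_add_eq h1
  have e3 : (X * G * G' * (G * Xᵀ)).trace
      = (G * G').trace - m * n * α * (G * G' * G).trace := by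
    calc _ = (X * (G * G' * (G * Xᵀ))).trace := by simp only [Matrix.mul_assoc]
      _ = (G * G' * (G * (Xᵀ * X))).trace := by
          rw [Matrix.trace_mul_comm]; simp only [Matrix.mul_assoc]
      _ = _ := by
          rw [hGX, Matrix.mul_sub, Matrix.mul_one, Matrix.mul_smul, Matrix.trace_sub,
            Matrix.trace_smul, smul_eq_mul]
  rw [e3]
  linear_combination σε ^ 2 * e1 + n ^ 2 * α * A * (α - γ) * e2
    - n * (γ - α) * (G * G').trace * hA + n * α * (G * G).trace * hA

theorem trace_conj_inv_ridge_nonneg {α γ : ℝ} (hγ : 0 < m * n * γ) :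
    0 ≤ ((X * (ridge m X α)⁻¹) * (ridge m X γ)⁻¹ * (X * (ridge m X α)⁻¹)ᵀ).trace :=
  ((posDef_ridge m X hγ).inv.posSemidef.mul_mul_conjTranspose_same
    (X * (ridge m X α)⁻¹)).trace_nonneg

theorem trace_conj_inv_ridge_pos {α γ : ℝ} (hα : IsUnit (ridge m X α)) (hγ : 0 < m * n * γ)
    (hX : X ≠ 0) :
    0 < ((X * (ridge m X α)⁻¹) * (ridge m X γ)⁻¹ * (X * (ridge m X α)⁻¹)ᵀ).trace := by
  have hdet := (Matrix.isUnit_iff_isUnit_det _).1 hα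
  have hpd := (posDef_ridge m X hγ).inv
  set B := X * (ridge m X α)⁻¹ with hB
  have hB0 : B ≠ 0 := by
    intro h
    apply hX
    rw [← Matrix.mul_one X, ← Matrix.nonsing_inv_mul _ hdet, ← Matrix.mul_assoc, ← hB, h,
      Matrix.zero_mul]
  have hps : (B * (ridge m X γ)⁻¹ * Bᵀ).PosSemidef :=
    hpd.posSemidef.mul_mul_conjTranspose_same B
  refine hps.trace_nonneg.lt_of_ne fun h0 => hB0 ?_
  have hz := hps.trace_eq_zero_iff.1 h0.symm
  ext i k
  by_contra hne
  have hrow : B i ≠ 0 := fun h => hne (congrFun h k)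
  have hp := hpd.dotProduct_mulVec_pos hrow
  have he : B i ⬝ᵥ ((ridge m X γ)⁻¹ *ᵥ B i) = (B * (ridge m X γ)⁻¹ * Bᵀ) i i := by
    rw [Matrix.dotProduct_mulVec, Matrix.mul_apply]
    simp only [dotProduct, Matrix.vecMul, Matrix.mul_apply, Matrix.transpose_apply]
  simp only [star_trivial] at hp
  rw [he, hz] at hp
  simp at hp

end Ridge

/-! ### Averaging over the target design -/

section TargetDesign

variable {d n : ℕ} {νx : Measure (Fin d → ℝ)}

/-- An isotropic design is not almost surely zero, since its entries have variance `1`. -/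
theorem frequently_design_ne_zero (hd : 0 < d) (hn : 0 < n) (hνx : IsIsotropic νx) :
    ∃ᵐ X ∂(Measure.pi fun _ : Fin n => νx), Matrix.of X ≠ 0 := by
  have := hνx.prob
  intro h
  have h0 : ∀ᵐ u ∂νx, u ⟨0, hd⟩ * u ⟨0, hd⟩ = 0 := by
    have hq := measurePreserving_eval (fun _ : Fin n => νx) ⟨0, hn⟩
    have hs : MeasurableSet {u : Fin d → ℝ | u ⟨0, hd⟩ * u ⟨0, hd⟩ = 0} :=
      measurableSet_eq_fun (by fun_prop) measurable_const
    rw [← hq.map_eq]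
    refine (ae_map_iff hq.aemeasurable hs).2 ?_
    filter_upwards [h] with X hX
    have hX0 : Matrix.of X = 0 := not_not.1 hX
    have h1 := congrFun (congrFun hX0 ⟨0, hn⟩) ⟨0, hd⟩
    simp only [Matrix.of_apply, Matrix.zero_apply] at h1
    simp [Function.eval, h1]
  have h1 := hνx.cov ⟨0, hd⟩ ⟨0, hd⟩
  rw [integral_eq_zero_of_ae h0] at h1
  simp at h1

variable (m : ℕ) (α : ℝ)

theorem measurable_trace_inv_ridge :
    Measurable fun X : Fin n → Fin d → ℝ => (ridge m (Matrix.of X) α)⁻¹.trace :=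
  Finset.measurable_sum _ fun i _ => measurable_inv_ridge (X := Matrix.of)
    (fun i j => by simp only [Matrix.of_apply]; fun_prop) α i i

theorem measurable_designError (σε A : ℝ) :
    Measurable fun X : Fin n → Fin d → ℝ => designError m (Matrix.of X) σε A α := by
  have hX : ∀ i j, Measurable fun X : Fin n → Fin d → ℝ => Matrix.of X i j := fun i j => by
    simp only [Matrix.of_apply]; fun_prop
  have h1 := measurable_inv_ridge (m := m) hX α
  have h2 := measurable_inv_ridge_mul (m := m) hX α
  have h3 : ∀ {p q : ℕ} {B : (Fin n → Fin d → ℝ) → Matrix (Fin p) (Fin q) ℝ},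
      (∀ i j, Measurable fun X => B X i j) → Measurable fun X => sqFrob (B X) := fun hB =>
    Finset.measurable_sum _ fun j _ => Finset.measurable_sum _ fun i _ => (hB i j).pow_const 2
  exact (measurable_const.add ((h3 h2).const_mul _)).add ((h3 h1).const_mul _)

variable {m α}

theorem integrable_trace_inv_ridge [IsProbabilityMeasure νx] (hα : 0 < m * n * α) :
    Integrable (fun X : Fin n → Fin d → ℝ => (ridge m (Matrix.of X) α)⁻¹.trace)
      (Measure.pi fun _ : Fin n => νx) := by
  refine Integrable.of_bound (measurable_trace_inv_ridge m α).aestronglyMeasurable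
    (d / (m * n * α)) (ae_of_all _ fun X => ?_)
  rw [Real.norm_of_nonneg (trace_inv_ridge_nonneg m _ hα.le (posDef_ridge m _ hα).isUnit)]
  exact trace_inv_ridge_le m _ hα

theorem lintegral_designError_opt [IsProbabilityMeasure νx] {σε A γ : ℝ} (hγ : 0 < m * n * γ)
    (hA : n * γ * A = m * σε ^ 2) :
    ∫⁻ X, ENNReal.ofReal (designError m (Matrix.of X) σε A γ) ∂(Measure.pi fun _ : Fin n => νx)
      = ENNReal.ofReal (σε ^ 2 * (1 + ∫ X : Fin n → Fin d → ℝ,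
          (ridge m (Matrix.of X) γ)⁻¹.trace ∂(Measure.pi fun _ : Fin n => νx))) := by
  have hI := integrable_trace_inv_ridge (d := d) (νx := νx) hγ
  have hK := fun X : Fin n → Fin d → ℝ => (posDef_ridge m (Matrix.of X) hγ).isUnit
  simp only [designError_eq m _ σε A (hK _), hA, sub_self, mul_zero, zero_mul, add_zero]
  have hI' : Integrable (fun X : Fin n → Fin d → ℝ =>
      σε ^ 2 * (1 + (ridge m (Matrix.of X) γ)⁻¹.trace)) (Measure.pi fun _ : Fin n => νx) :=
    ((integrable_const 1).add hI).const_mul _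
  rw [← ofReal_integral_eq_lintegral_ofReal hI']
  · rw [integral_const_mul, integral_add (integrable_const 1) hI]
    simp
  · exact ae_of_all _ fun X => mul_nonneg (sq_nonneg _)
      (add_nonneg zero_le_one (trace_inv_ridge_nonneg m _ hγ.le (hK X)))

theorem lintegral_designError_opt_lt (hd : 0 < d) (hn : 0 < n) (hνx : IsIsotropic νx)
    {σε A γ : ℝ} (hA0 : 0 < A) (hγ : 0 < m * n * γ) (hA : n * γ * A = m * σε ^ 2)
    (hα : 0 < m * n * α) (hne : α ≠ γ) :
    ∫⁻ X, ENNReal.ofReal (designError m (Matrix.of X) σε A γ) ∂(Measure.pi fun _ : Fin n => νx)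
      < ∫⁻ X, ENNReal.ofReal (designError m (Matrix.of X) σε A α)
        ∂(Measure.pi fun _ : Fin n => νx) := by
  have := hνx.prob
  have hKα := fun X : Fin n → Fin d → ℝ => (posDef_ridge m (Matrix.of X) hα).isUnit
  have hKγ := fun X : Fin n → Fin d → ℝ => (posDef_ridge m (Matrix.of X) hγ).isUnit
  have hc : 0 < A * n ^ 2 * (α - γ) ^ 2 := by
    have := sub_ne_zero.2 hne
    positivity
  refine lintegral_strict_mono_of_ae_le_of_frequently_ae_lt
    (ENNReal.measurable_ofReal.comp (measurable_designError m α σε A)).aemeasurable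
    (by rw [lintegral_designError_opt hγ hA]; exact ENNReal.ofReal_ne_top)
    (ae_of_all _ fun X => ENNReal.ofReal_le_ofReal ?_)
    ((frequently_design_ne_zero hd hn hνx).mono fun X hX => ?_)
  · have h := mul_nonneg hc.le (trace_conj_inv_ridge_nonneg m (Matrix.of X) (α := α) hγ)
    rw [← designError_sub m _ σε A hA (hKα X) (hKγ X)] at h
    exact sub_nonneg.1 h
  · have h := mul_pos hc (trace_conj_inv_ridge_pos m (Matrix.of X) (hKα X) hγ hX)
    rw [← designError_sub m _ σε A hA (hKα X) (hKγ X)] at h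
    have h0 : 0 ≤ designError m (Matrix.of X) σε A γ := by
      have h1 := sqFrob_nonneg ((ridge m (Matrix.of X) γ)⁻¹ * (Matrix.of X)ᵀ)
      have h2 := sqFrob_nonneg (ridge m (Matrix.of X) γ)⁻¹
      unfold designError
      positivity
    exact ((ENNReal.ofReal_lt_ofReal_iff_of_nonneg h0).2 (sub_pos.1 h)).ne

end TargetDesign

/-! ### The optimal hyperparameter -/

theorem alphaOpt_eq {m d n : ℕ} {nt : Fin m → ℕ} {b σε A : ℝ} {ση σξ : Fin m → ℝ}
    (hA0 : 0 < A) (hA : totalConst d nt b ση σξ = ENNReal.ofReal A) :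
    alphaOpt d n nt b σε ση σξ = m * σε ^ 2 / (n * A) := by
  rw [alphaOpt, hA, ENNReal.toReal_div, ENNReal.toReal_mul, ENNReal.toReal_mul,
    ENNReal.toReal_ofReal hA0.le, ENNReal.toReal_ofReal (sq_nonneg _), ENNReal.toReal_natCast,
    ENNReal.toReal_natCast]

theorem alphaOpt_eq_zero {m d n : ℕ} {nt : Fin m → ℕ} (hn : 0 < n) {b : ℝ} (σε : ℝ)
    {ση σξ : Fin m → ℝ} {j : Fin m} (hj : sourceConst d (nt j) b (ση j) (σξ j) = ⊤) :
    alphaOpt d n nt b σε ση σξ = 0 := by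
  have htop : totalConst d nt b ση σξ = ⊤ := by
    rw [totalConst, ENNReal.sum_eq_top.2 ⟨j, Finset.mem_univ j, hj⟩, top_add]
  rw [alphaOpt, htop, ENNReal.mul_top (by exact_mod_cast hn.ne'), ENNReal.div_top,
    ENNReal.toReal_zero]

/-- For `α = 0` the source tasks do not contribute, however ill-conditioned they are. -/
theorem condError_zero {m d n : ℕ} {nt : Fin m → ℕ} (H : Fin m → Matrix (Fin d) (Fin d) ℝ)
    (X : Matrix (Fin n) (Fin d) ℝ) (Z : (j : Fin m) → Matrix (Fin (nt j)) (Fin d) ℝ)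
    (b σε : ℝ) (ση σξ : Fin m → ℝ) (hK : IsUnit (ridge m X 0)) :
    condError H 0 X Z b σε ση σξ = σε ^ 2 * (1 + (ridge m X 0)⁻¹.trace) := by
  have h0 : ∀ p q : ℕ, sqFrob (0 : Matrix (Fin p) (Fin q) ℝ) = 0 := fun p q => by simp [sqFrob]
  rw [← sqFrob_inv_ridge_mul_add m X hK]
  simp [condError, sourceCoeff, taskCoeff, biasCoeff, h0]
  ring

section TestError

variable {Ω : Type*} [MeasurableSpace Ω] {P : Measure Ω} {m d n : ℕ} {nt : Fin m → ℕ} {b σε : ℝ}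
  {ση σξ : Fin m → ℝ} {νx : Measure (Fin d → ℝ)} {νε : Measure ℝ} {νξ : Fin m → Measure ℝ}
  {S : Ω → Sample m d n nt} {H : Fin m → Matrix (Fin d) (Fin d) ℝ}

theorem testError_eq_lintegral_designError (hd : 0 < d) (hnt : ∀ j, 0 < nt j) (hb : 0 ≤ b)
    (hνx : IsIsotropic νx) (hνε : IsNoise νε (σε ^ 2)) (hνξ : ∀ j, IsNoise (νξ j) (σξ j ^ 2))
    (hS : HasLaw (fun ω => (S ω).toTuple) (jointLaw m d n nt b ση νξ νx νε) P)
    (horth : ∀ j, (H j)ᵀ * H j = 1) (hfin : ∀ j, d + 2 ≤ nt j ∨ nt j + 2 ≤ d) {α : ℝ}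
    (hα : 0 < m * n * α) :
    testError P S H H α = ∫⁻ X, ENNReal.ofReal
      (designError m (Matrix.of X) σε (sourceMoment d nt b ση σξ) α)
      ∂(Measure.pi fun _ : Fin n => νx) := by
  rw [testError_eq_lintegral_condError hb hνx hνε hνξ hS H horth α
    (ae_of_all _ fun X => (posDef_ridge m (Matrix.of X) hα).isUnit)]
  exact lintegral_congr fun X =>
    lintegral_condError hd hnt horth hfin hb σε ση σξ α (Matrix.of X)

theorem testError_eq_top (hd : 0 < d) (hn : 0 < n) (hnt : ∀ j, 0 < nt j) (hb : 0 ≤ b)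
    (hνx : IsIsotropic νx) (hνε : IsNoise νε (σε ^ 2)) (hνξ : ∀ j, IsNoise (νξ j) (σξ j ^ 2))
    (hS : HasLaw (fun ω => (S ω).toTuple) (jointLaw m d n nt b ση νξ νx νε) P)
    (horth : ∀ j, (H j)ᵀ * H j = 1) {j : Fin m} (hj : ¬ d + 2 ≤ nt j ∧ ¬ nt j + 2 ≤ d)
    (hσ : 0 < σξ j) {α : ℝ} (hα : 0 < α) :
    testError P S H H α = ⊤ := by
  have := hνx.prob
  have hm : 0 < m := j.pos
  have hα' : 0 < m * n * α := by positivity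
  have hK := fun X : Fin n → Fin d → ℝ => (posDef_ridge m (Matrix.of X) hα').isUnit
  rw [testError_eq_lintegral_condError hb hνx hνε hνξ hS H horth α (ae_of_all _ hK),
    lintegral_congr fun X => lintegral_condError_eq_top hd hn hnt horth hj hb σε ση σξ hσ hα
      (Matrix.of X) (hK X)]
  simp

/-- Without transfer, the test error is that of least squares regression on the target data. -/
theorem testError_zero (hb : 0 ≤ b) (hνx : IsIsotropic νx) (hνε : IsNoise νε (σε ^ 2))
    (hνξ : ∀ j, IsNoise (νξ j) (σξ j ^ 2))
    (hS : HasLaw (fun ω => (S ω).toTuple) (jointLaw m d n nt b ση νξ νx νε) P)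
    (horth : ∀ j, (H j)ᵀ * H j = 1) (hK : ∀ᵐ ω ∂P, IsUnit (ridge m (S ω).X 0)) :
    testError P S H H 0 = ENNReal.ofReal (σε ^ 2) *
      (1 + ∫⁻ ω, ENNReal.ofReal (ridge m (S ω).X 0)⁻¹.trace ∂P) := by
  have := hνx.prob
  have := hνε.prob
  have := fun j => (hνξ j).prob
  have hX := hasLaw_X hS
  have hKX : ∀ᵐ X ∂(Measure.pi fun _ : Fin n => νx), IsUnit (ridge m (Matrix.of X) 0) := by
    refine (hX.ae_iff ?_).1 hK
    simp only [Matrix.isUnit_iff_isUnit_det, isUnit_iff_ne_zero]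
    have hdet : Measurable fun X : Fin n → Fin d → ℝ => (ridge m (Matrix.of X) 0).det := by
      refine measurable_matrix_det fun i j => ?_
      simp only [ridge, Matrix.add_apply, Matrix.mul_apply, Matrix.transpose_apply,
        Matrix.of_apply]
      fun_prop
    exact (hdet (measurableSet_singleton 0).compl).mem
  have hm : Measurable fun X : Fin n → Fin d → ℝ =>
      ENNReal.ofReal (ridge m (Matrix.of X) 0)⁻¹.trace :=
    ENNReal.measurable_ofReal.comp (measurable_trace_inv_ridge m 0)
  rw [testError_eq_lintegral_condError hb hνx hνε hνξ hS H horth 0 hKX]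
  have h1 : ∫⁻ ω, ENNReal.ofReal (ridge m (S ω).X 0)⁻¹.trace ∂P
      = ∫⁻ X, ENNReal.ofReal (ridge m (Matrix.of X) 0)⁻¹.trace
        ∂(Measure.pi fun _ : Fin n => νx) := hX.lintegral_comp hm.aemeasurable
  have h2 : ∫⁻ X : Fin n → Fin d → ℝ, (1 + ENNReal.ofReal (ridge m (Matrix.of X) 0)⁻¹.trace)
        ∂(Measure.pi fun _ : Fin n => νx)
      = 1 + ∫⁻ X, ENNReal.ofReal (ridge m (Matrix.of X) 0)⁻¹.trace
        ∂(Measure.pi fun _ : Fin n => νx) := by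
    rw [lintegral_add_left measurable_const]
    simp
  rw [h1, ← h2, ← lintegral_const_mul _ (hm.const_add 1)]
  refine lintegral_congr_ae ?_
  filter_upwards [hKX] with X hKX
  simp only [condError_zero H (Matrix.of X) _ b σε ση σξ hKX, lintegral_const, measure_univ,
    mul_one]
  rw [ENNReal.ofReal_mul (sq_nonneg _), ENNReal.ofReal_add zero_le_one
    (trace_inv_ridge_nonneg m _ (by simp) hKX), ENNReal.ofReal_one]

end TestError

end

end TransferLearning

theorem mainTheorem2 {Ω : Type*} [MeasurableSpace Ω] (P : MeasureTheory.Measure Ω)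
    (m d n : ℕ) (nt : Fin m → ℕ) (hd : 0 < d) (hn : 0 < n) (hnt : ∀ j, 0 < nt j)
    (b σε : ℝ) (ση σξ : Fin m → ℝ) (hb : 0 < b) (hσε : 0 < σε)
    (hση : ∀ j, 0 ≤ ση j) (hσξ : ∀ j, 0 ≤ σξ j)
    -- the distributions of the target input, of the target noise and of the source noises
    (νx : MeasureTheory.Measure (Fin d → ℝ)) (hνx : TransferLearning.IsIsotropic νx)
    (νε : MeasureTheory.Measure ℝ) (hνε : TransferLearning.IsNoise νε (σε ^ 2))
    (νξ : Fin m → MeasureTheory.Measure ℝ)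
    (hνξ : ∀ j, TransferLearning.IsNoise (νξ j) (σξ j ^ 2))
    -- the random quantities
    (S : Ω → TransferLearning.Sample m d n nt)
    (hS : ProbabilityTheory.HasLaw (fun ω => (S ω).toTuple)
      (TransferLearning.jointLaw m d n nt b ση νξ νx νε) P)
    -- the true and the assumed task relations
    (H Ht : Fin m → Matrix (Fin d) (Fin d) ℝ)
    (hfull : IsUnit (∑ j, (Ht j)ᵀ * Ht j))
    (hwell : ∀ j, Ht j = H j) (horth : ∀ j, (H j)ᵀ * H j = 1)
    -- the denominator of the optimal hyperparameter is not zero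
    (hA : TransferLearning.totalConst d nt b ση σξ ≠ 0)
    -- a source task at its interpolation threshold is noisy
    (hpeak : ∀ j, TransferLearning.sourceConst d (nt j) b (ση j) (σξ j) = ⊤ → 0 < σξ j) :
    let αopt : ℝ := TransferLearning.alphaOpt d n nt b σε ση σξ
    let err : ℝ → ℝ≥0∞ := TransferLearning.testError P S H Ht
    let tr : Ω → ℝ := fun ω =>
      Matrix.trace ((S ω).Xᵀ * (S ω).X + (m * n * αopt) • (1 : Matrix (Fin d) (Fin d) ℝ))⁻¹
    -- all the constants are finite
    ((∀ j, TransferLearning.sourceConst d (nt j) b (ση j) (σξ j) ≠ ⊤) →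
      0 < αopt ∧
      (∀ α : ℝ, 0 < α → α ≠ αopt → err αopt < err α) ∧
      MeasureTheory.Integrable tr P ∧
      err αopt = ENNReal.ofReal (σε ^ 2 * (1 + ∫ ω, tr ω ∂P))) ∧
    -- some constant is infinite
    ((∃ j, TransferLearning.sourceConst d (nt j) b (ση j) (σξ j) = ⊤) →
      αopt = 0 ∧
      (∀ α : ℝ, 0 < α → err α = ⊤) ∧
      ((∀ᵐ ω ∂P, IsUnit ((S ω).Xᵀ * (S ω).X)) →
        err αopt = ENNReal.ofReal (σε ^ 2) * (1 + ∫⁻ ω, ENNReal.ofReal (tr ω) ∂P))) := by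
  obtain rfl : Ht = H := funext hwell
  -- without source tasks the denominator would be an empty sum
  have hm : 0 < m := by
    refine Nat.pos_of_ne_zero fun h0 => hA ?_
    subst h0
    simp [TransferLearning.totalConst]
  have := hνx.prob
  have := hνε.prob
  have := fun j => (hνξ j).prob
  have hX := TransferLearning.hasLaw_X hS
  intro αopt err tr
  refine ⟨fun hC => ?_, ?_⟩
  · have hfin := fun j => (TransferLearning.sourceConst_ne_top_iff d (nt j) b (ση j) (σξ j)).1 (hC j)
    have hA' := TransferLearning.totalConst_eq_ofReal hd hb.le ση σξ hfin
    set A := TransferLearning.sourceMoment d nt b ση σξ with hAdef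
    have hA0 : 0 < A := by
      rw [hA'] at hA
      exact ENNReal.ofReal_pos.1 (pos_iff_ne_zero.2 hA)
    have hopt : αopt = m * σε ^ 2 / (n * A) := TransferLearning.alphaOpt_eq hA0 hA'
    have hopt0 : 0 < αopt := by rw [hopt]; positivity
    have hγ : 0 < m * n * αopt := by positivity
    have hγA : n * αopt * A = m * σε ^ 2 := by rw [hopt]; field_simp
    have herr : ∀ {α : ℝ}, 0 < m * n * α → err α = _ := fun hα =>
      TransferLearning.testError_eq_lintegral_designError hd hnt hb.le hνx hνε hνξ hS horth hfin hα
    have hI := TransferLearning.integrable_trace_inv_ridge (d := d) (νx := νx) hγ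
    refine ⟨hopt0, fun α hα hne => ?_, ?_, ?_⟩
    · have hα' : 0 < m * n * α := by positivity
      rw [herr hγ, herr hα']
      exact TransferLearning.lintegral_designError_opt_lt hd hn hνx hA0 hγ hγA hα' hne
    · rw [← hX.map_eq] at hI
      exact hI.comp_aemeasurable hX.aemeasurable
    · rw [herr hγ, TransferLearning.lintegral_designError_opt hγ hγA]
      congr 3
      exact (hX.integral_comp hI.aestronglyMeasurable).symm
  · rintro ⟨j, hj⟩
    have hopt : αopt = 0 := TransferLearning.alphaOpt_eq_zero hn σε hj
    have hj' : ¬ d + 2 ≤ nt j ∧ ¬ nt j + 2 ≤ d := by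
      rw [← not_or, ← TransferLearning.sourceConst_ne_top_iff d (nt j) b (ση j) (σξ j), not_not]
      exact hj
    refine ⟨hopt, fun α hα => TransferLearning.testError_eq_top hd hn hnt hb.le hνx hνε hνξ hS horth
      hj' (hpeak j hj) hα, fun hU => ?_⟩
    have h := TransferLearning.testError_zero hb.le hνx hνε hνξ hS horth
      (hU.mono fun ω hω => by simpa [TransferLearning.ridge] using hω)
    rw [← hopt] at h
    exact h
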